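/- **Theorem 2.1.** Let $n\ge 2$, let $\Omega\subset\mathbb R^n$ be a bounded domain, and let $g:\Omega\times\mathbb R_+\to\mathbb R_+$ be such that $g(\cdot,{\rm v})$ is measurable for every ${\rm v}>0$ and, for every $x\in\Omega$, the function ${\rm v}\mapsto g(x,{\rm v})$ is increasing, $\lim_{{\rm v}\to0}g(x,{\rm v})=0$, $\lim_{{\rm v}\to+\infty}g(x,{\rm v})=+\infty$, and $c_0^{-1}\le g(x,1)\le c_0$ with some $c_0>0$ independent of $x$. Let $x_0\in\Omega$, and let $R>0$ be such that $B_R(x_0)\subset\Omega$. Assume: * $({\rm g}_1)$ there exist $1<p<q$ such that for all $x\in\Omega$ and all ${\rm w}\ge{\rm v}>0$ $$\left(\frac{\rm w}{\rm v}\right)^{p-1}\le\frac{g(x,{\rm w})}{g(x,{\rm v})}\le\left(\frac{\rm w}{\rm v}\right)^{q-1};$$ * $({\rm g}_2)$ $\lambda$ is a positive, continuous and non-decreasing function on $(0,R)$ with $\lambda(r)\le1$ such that, for some $\delta_0\in(0,1)$, $\lim_{r\to0}r^{1-\delta_0}/\lambda(r)=0$ and $\lambda(r)\le(3/2)^{1-\delta_0}\lambda(r/2)$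 for all $r\in(0,R)$; and there exists $c>0$ such that for every $K\ge1$ $$g(x,{\rm v}/r)\le c\,K^{c}\,g(y,{\rm v}/r)\qquad\text{for all } 0<r<R,\ x,y\in B_r(x_0),\ r\le{\rm v}\le K\lambda(r);$$ * $\displaystyle\int_0\lambda(t)\,\frac{dt}{t}=+\infty$ (divergence at $0$). Then every function $u$ of the elliptic De Giorgi class $\mathcal B_{1,g}(\Omega)$ is continuous at $x_0$, that is, $u$ coincides a.e. in $\Omega$ with a function that is continuous at $x_0$. Here, for a given number $M$, a measurable function $u:\Omega\to\mathbb R$ belongs to $\mathcal B_{1,g}(\Omega)$ if $u\in W^{1,1}_{\rm loc}(\Omega)\cap L^\infty(\Omega)$, $\operatorname{ess\,sup}_\Omega|u|\le M$, and there exist numbers $1<p<q$ (not necessarily those of $({\rm g}_1)$), $c_1>0$ and $\kappa>1$ such that for every ball $B_{8r}(y)\subset\Omega$, all $k<l$ with $|k|,|l|<M$, all $\varepsilon\in(0,1]$, all $\sigma\in(0,1)$ and all $\zeta\in C_0^\infty(B_r(y))$ with $0\le\zeta\le1$, $\zeta=1$ in $B_{r(1-\sigma)}(y)$ and $|\nabla\zeta|\le\kappa(\sigma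 r)^{-1}$, $$\int_{A^+_{k,r}\setminus A^+_{l,r}}g\Big(x,\tfrac{M_+(k,r)}{r}\Big)|\nabla u|\,\zeta^q\,dx\le c_1\frac{M_+(k,r)}{\varepsilon r}\int_{A^+_{k,r}\setminus A^+_{l,r}}g\Big(x,\tfrac{M_+(k,r)}{r}\Big)dx+c_1\sigma^{-q}\varepsilon^{p-1}\int_{A^+_{k,r}}g\Big(x,\tfrac{M_+(k,r)}{r}\Big)\frac{(u-k)_+}{r}\,dx,$$ $$\int_{A^-_{l,r}\setminus A^-_{k,r}}g\Big(x,\tfrac{M_-(l,r)}{r}\Big)|\nabla u|\,\zeta^q\,dx\le c_1\frac{M_-(l,r)}{\varepsilon r}\int_{A^-_{l,r}\setminus A^-_{k,r}}g\Big(x,\tfrac{M_-(l,r)}{r}\Big)dx+c_1\sigma^{-q}\varepsilon^{p-1}\int_{A^-_{l,r}}g\Big(x,\tfrac{M_-(l,r)}{r}\Big)\frac{(u-l)_-}{r}\,dx,$$ where $(u-k)_\pm:=\max\{\pm(u-k),0\}$, $A^\pm_{k,r}:=B_r(y)\cap\{(u-k)_\pm>0\}$ and $M_\pm(k,r):=\operatorname{ess\,sup}_{B_r(y)}(u-k)_\pm$.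 -/

import Mathlib

open MeasureTheory Set Filter Topology
open scoped ContDiff

noncomputable section

namespace DeGiorgiB1

/-- The Euclidean space `ℝⁿ`, with the Euclidean norm and Lebesgue measure. -/
abbrev Eucl (n : ℕ) : Type := EuclideanSpace ℝ (Fin n)

/-- `Du` is a weak gradient of `u` in the open set `Ω`, both being locally integrable in `Ω`;
so `∃ Du, HasWeakGradient Ω u Du` says that `u` belongs to `W^{1,1}_loc(Ω)`. -/
structure HasWeakGradient {n : ℕ} (Ω : Set (Eucl n)) (u : Eucl n → ℝ)
    (Du : Eucl n → Eucl n) : Prop where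
  locallyIntegrableOn : LocallyIntegrableOn u Ω volume
  locallyIntegrableOn_grad : LocallyIntegrableOn Du Ω volume
  integral_eq : ∀ φ : Eucl n → ℝ, ContDiff ℝ ∞ φ → HasCompactSupport φ → tsupport φ ⊆ Ω →
    ∀ e : Eucl n,
      ∫ x in Ω, u x * fderiv ℝ φ x e = -∫ x in Ω, inner ℝ (Du x) e * φ x

/-- The standing assumptions on `g : Ω × (0, ∞) → [0, ∞)`. -/
structure IsGrowthFunction {n : ℕ} (Ω : Set (Eucl n)) (g : Eucl n → ℝ → ℝ) : Prop where
  aemeasurable : ∀ v : ℝ, 0 < v → AEMeasurable (fun x => g x v) (volume.restrict Ω)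
  nonneg : ∀ x ∈ Ω, ∀ v : ℝ, 0 < v → 0 ≤ g x v
  mono : ∀ x ∈ Ω, MonotoneOn (g x) (Ioi 0)
  tendsto_zero : ∀ x ∈ Ω, Tendsto (g x) (𝓝[>] 0) (𝓝 0)
  tendsto_atTop : ∀ x ∈ Ω, Tendsto (g x) atTop atTop
  at_one : ∃ c₀ : ℝ, 0 < c₀ ∧ ∀ x ∈ Ω, c₀⁻¹ ≤ g x 1 ∧ g x 1 ≤ c₀

/-- Condition (g₁): growth of `g x` between the powers `p - 1` and `q - 1`. (The lower bound
forces `g x v ≠ 0`, so the quotient is a genuine one.) -/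
def CondG1 {n : ℕ} (Ω : Set (Eucl n)) (g : Eucl n → ℝ → ℝ) : Prop :=
  ∃ p q : ℝ, 1 < p ∧ p < q ∧
    ∀ x ∈ Ω, ∀ v w : ℝ, 0 < v → v ≤ w →
      (w / v) ^ (p - 1) ≤ g x w / g x v ∧ g x w / g x v ≤ (w / v) ^ (q - 1)

/-- Condition (g₂) at the point `x₀`, on the scale `R`, with the function `lam`. -/
def CondG2 {n : ℕ} (g : Eucl n → ℝ → ℝ) (x₀ : Eucl n) (R : ℝ) (lam : ℝ → ℝ) : Prop :=
  ContinuousOn lam (Ioo 0 R) ∧ MonotoneOn lam (Ioo 0 R) ∧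
  (∀ r ∈ Ioo 0 R, 0 < lam r ∧ lam r ≤ 1) ∧
  (∃ δ₀ : ℝ, 0 < δ₀ ∧ δ₀ < 1 ∧
    Tendsto (fun r : ℝ => r ^ (1 - δ₀) / lam r) (𝓝[>] 0) (𝓝 0) ∧
    ∀ r ∈ Ioo 0 R, lam r ≤ (3 / 2 : ℝ) ^ (1 - δ₀) * lam (r / 2)) ∧
  ∃ c : ℝ, 0 < c ∧ ∀ K : ℝ, 1 ≤ K → ∀ r ∈ Ioo 0 R,
    ∀ x ∈ Metric.ball x₀ r, ∀ y ∈ Metric.ball x₀ r, ∀ v : ℝ, r ≤ v → v ≤ K * lam r →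
      g x (v / r) ≤ c * K ^ c * g y (v / r)

/-- `∫₀ lam(t) dt / t = +∞` (divergence at `0`). -/
def DivergesAtZero (R : ℝ) (lam : ℝ → ℝ) : Prop :=
  ∀ ρ ∈ Ioo 0 R, ∫⁻ t in Ioo 0 ρ, ENNReal.ofReal (lam t / t) = ⊤

/-- The superlevel set `A⁺_{k,r}`: the points of `B_r(y)` with `(u - k)₊ > 0`. -/
def APlus {n : ℕ} (u : Eucl n → ℝ) (y : Eucl n) (k r : ℝ) : Set (Eucl n) :=
  {x ∈ Metric.ball y r | 0 < max (u x - k) 0}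

/-- The sublevel set `A⁻_{k,r}`: the points of `B_r(y)` with `(u - k)₋ > 0`. -/
def AMinus {n : ℕ} (u : Eucl n → ℝ) (y : Eucl n) (k r : ℝ) : Set (Eucl n) :=
  {x ∈ Metric.ball y r | 0 < max (-(u x - k)) 0}

/-- `M₊(k,r)`, the essential supremum of `(u - k)₊` over `B_r(y)`. -/
def MPlus {n : ℕ} (u : Eucl n → ℝ) (y : Eucl n) (k r : ℝ) : ℝ :=
  essSup (fun x => max (u x - k) 0) (volume.restrict (Metric.ball y r))

/-- `M₋(k,r)`, the essential supremum of `(u - k)₋` over `B_r(y)`. -/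
def MMinus {n : ℕ} (u : Eucl n → ℝ) (y : Eucl n) (k r : ℝ) : ℝ :=
  essSup (fun x => max (-(u x - k)) 0) (volume.restrict (Metric.ball y r))

/-- `ζ ∈ C₀^∞(B_r(y))`, `0 ≤ ζ ≤ 1`, `ζ = 1` in `B_{r(1-σ)}(y)` and `|∇ζ| ≤ κ (σ r)⁻¹`. -/
structure IsCutoff {n : ℕ} (κ : ℝ) (y : Eucl n) (r σ : ℝ) (ζ : Eucl n → ℝ) : Prop where
  contDiff : ContDiff ℝ ∞ ζ
  hasCompactSupport : HasCompactSupport ζ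
  tsupport_subset : tsupport ζ ⊆ Metric.ball y r
  nonneg : ∀ x, 0 ≤ ζ x
  le_one : ∀ x, ζ x ≤ 1
  eq_one : ∀ x ∈ Metric.ball y (r * (1 - σ)), ζ x = 1
  norm_fderiv_le : ∀ x, ‖fderiv ℝ ζ x‖ ≤ κ * (σ * r)⁻¹

/-- The energy inequality for the upper level sets of `u` (with weak gradient `Du`). -/
def EnergyPlus {n : ℕ} (g : Eucl n → ℝ → ℝ) (u : Eucl n → ℝ) (Du : Eucl n → Eucl n)
    (p q c₁ : ℝ) (y : Eucl n) (r k l ε σ : ℝ) (ζ : Eucl n → ℝ) : Prop :=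
  (∫ x in APlus u y k r \ APlus u y l r, g x (MPlus u y k r / r) * ‖Du x‖ * ζ x ^ q)
    ≤ c₁ * (MPlus u y k r / (ε * r)) *
        (∫ x in APlus u y k r \ APlus u y l r, g x (MPlus u y k r / r))
      + c₁ * σ ^ (-q) * ε ^ (p - 1) *
        (∫ x in APlus u y k r, g x (MPlus u y k r / r) * (max (u x - k) 0 / r))

/-- The energy inequality for the lower level sets of `u` (with weak gradient `Du`). -/
def EnergyMinus {n : ℕ} (g : Eucl n → ℝ → ℝ) (u : Eucl n → ℝ) (Du : Eucl n → Eucl n)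
    (p q c₁ : ℝ) (y : Eucl n) (r k l ε σ : ℝ) (ζ : Eucl n → ℝ) : Prop :=
  (∫ x in AMinus u y l r \ AMinus u y k r, g x (MMinus u y l r / r) * ‖Du x‖ * ζ x ^ q)
    ≤ c₁ * (MMinus u y l r / (ε * r)) *
        (∫ x in AMinus u y l r \ AMinus u y k r, g x (MMinus u y l r / r))
      + c₁ * σ ^ (-q) * ε ^ (p - 1) *
        (∫ x in AMinus u y l r, g x (MMinus u y l r / r) * (max (-(u x - l)) 0 / r))

/-- The elliptic De Giorgi class `B_{1,g}(Ω)` of functions `u ∈ W^{1,1}_loc(Ω) ∩ L^∞(Ω)` with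
`ess sup_Ω |u| ≤ M`. -/
def DeGiorgiClass {n : ℕ} (Ω : Set (Eucl n)) (g : Eucl n → ℝ → ℝ) (M : ℝ) :
    Set (Eucl n → ℝ) :=
  {u | (∀ᵐ x ∂volume.restrict Ω, |u x| ≤ M) ∧
    ∃ Du : Eucl n → Eucl n, HasWeakGradient Ω u Du ∧
    ∃ p q c₁ κ : ℝ, 1 < p ∧ p < q ∧ 0 < c₁ ∧ 1 < κ ∧
      ∀ (y : Eucl n) (r : ℝ), 0 < r → Metric.ball y (8 * r) ⊆ Ω →
      ∀ k l : ℝ, k < l → |k| < M → |l| < M →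
      ∀ ε : ℝ, 0 < ε → ε ≤ 1 → ∀ σ : ℝ, 0 < σ → σ < 1 →
      ∀ ζ : Eucl n → ℝ, IsCutoff κ y r σ ζ →
        EnergyPlus g u Du p q c₁ y r k l ε σ ζ ∧ EnergyMinus g u Du p q c₁ y r k l ε σ ζ}

/-- A function given up to null sets is continuous at `x₀` if it agrees almost everywhere in `Ω`
with a function that is continuous at `x₀`. -/
def HasRepContinuousAt {n : ℕ} (Ω : Set (Eucl n)) (u : Eucl n → ℝ) (x₀ : Eucl n) : Prop :=
  ∃ w : Eucl n → ℝ, w =ᵐ[volume.restrict Ω] u ∧ ContinuousAt w x₀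

end DeGiorgiB1

end

/-! Let D be at most M λ(r), and let k be a level with sup u ≤ k + D on a ball of radius ρ
comparable to r. Unless the supremum already drops below k + ρ, the number v = `MPlus u x₀ k ρ` lies
between ρ and a multiple of λ(ρ). This is the range in which (g₂) makes g(x, v/ρ) comparable to a
constant on the ball. The weight then cancels from the energy inequality
(`EnergyPlus.integral_norm_le`). What remains is an L¹ bound for the gradient on level strips
(`LevelGradientBound`), to which the W^{1,1} forms of De Giorgi's arguments apply.

Suppose that m ≤ u ≤ μ and that u lies below the midpoint on half of the ball. The isoperimetric
inequality is applied at the levels μ - D₀ 2⁻ˢ with D₀ = λ(r)(μ - m)/2. The strips between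
consecutive levels are disjoint, so after a fixed number N of steps the set above the last level is
as small as desired; the parameter ε absorbs the part of the energy that does not telescope. De
Giorgi's iteration, based on the Sobolev inequality, turns small measure into a pointwise bound.
Thus the supremum falls by η λ(r)(μ - m) on the half ball (`exists_reduction`). If the half-measure
condition fails for u, it holds for -u, so in either case the oscillation falls by this amount.

The reduction is available as long as r ≤ η λ(r)(μ - m). If the bounds of the oscillation at the
radii r₀ 2⁻ʲ had a positive limit L, this would hold for all large j, because r^(1-δ₀)/λ(r) → 0. The
losses, each at least η L λ(r₀ 2⁻ʲ), would have a finite sum, whereas divergence of ∫ λ(t) dt/t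
makes the sum of the λ(r₀ 2⁻ʲ) infinite (`tendsto_zero_of_dyadic_decay`). Oscillation tending to
zero gives a representative continuous at x₀. -/

noncomputable section

namespace DeGiorgiB1

open scoped Convolution ENNReal

/-! ### Mollification of weakly differentiable functions -/

/-- Translations act continuously on `L¹`. -/
theorem tendsto_lintegral_translate_sub {E F : Type*} [NormedAddCommGroup E] [InnerProductSpace ℝ E]
    [FiniteDimensional ℝ E] [MeasurableSpace E] [BorelSpace E] {μ : Measure E}
    [μ.IsAddHaarMeasure] [NormedAddCommGroup F] 
    {f : E → F} (hf : Integrable f μ) :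
    Tendsto (fun t : E => ∫⁻ x, ‖f (t + x) - f x‖ₑ ∂μ) (𝓝 0) (𝓝 0) := by
  have : Fact ((1 : ℝ≥0∞) ≤ 1) := ⟨le_rfl⟩
  have : Fact ((1 : ℝ≥0∞) ≠ ⊤) := ⟨ENNReal.one_ne_top⟩
  have hf' : MemLp f 1 μ := memLp_one_iff_integrable.2 hf
  have h1 : Tendsto (fun t : E => edist (DomAddAct.mk t +ᵥ hf'.toLp f) (hf'.toLp f))
      (𝓝 0) (𝓝 0) := by
    have hc : Continuous fun t : E => edist (DomAddAct.mk t +ᵥ hf'.toLp f) (hf'.toLp f) := by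
      have : Continuous fun t : E => DomAddAct.mk t +ᵥ hf'.toLp f :=
        (DomAddAct.continuous_mk).vadd continuous_const
      exact this.edist continuous_const
    have := hc.tendsto 0
    simpa using this
  refine h1.congr fun t => ?_
  rw [Lp.edist_def, eLpNorm_one_eq_lintegral_enorm]
  refine lintegral_congr_ae ?_
  have h2 := DomAddAct.vadd_Lp_ae_eq (DomAddAct.mk t) (hf'.toLp f)
  have h3 := hf'.coeFn_toLp
  have h4 := (measurePreserving_add_left μ t).quasiMeasurePreserving.ae_eq_comp h3
  filter_upwards [h2, h3, h4] with x hx2 hx3 hx4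
  simp only [Function.comp_apply] at hx4
  simp only [Pi.sub_apply, hx2, hx3]
  simp [hx4]

/-- Mollifications converge in `L¹`. -/
theorem tendsto_lintegral_convolution_sub {E F : Type*} [NormedAddCommGroup E] [InnerProductSpace ℝ E]
    [FiniteDimensional ℝ E] [MeasurableSpace E] [BorelSpace E] {μ : Measure E}
    [μ.IsAddHaarMeasure] [NormedAddCommGroup F] [NormedSpace ℝ F] [CompleteSpace F]
    {f : E → F} (hf : Integrable f μ)
    (φ : ℕ → ContDiffBump (0 : E)) (hφ : Tendsto (fun i => (φ i).rOut) atTop (𝓝 0)) :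
    Tendsto (fun i => ∫⁻ x, ‖((φ i).normed μ ⋆[ContinuousLinearMap.lsmul ℝ ℝ, μ] f) x - f x‖ₑ ∂μ)
      atTop (𝓝 0) := by
  rw [ENNReal.tendsto_atTop_zero]
  intro ε hε
  have h1 := (ENNReal.tendsto_nhds_zero.1 (tendsto_lintegral_translate_sub hf)) ε hε
  obtain ⟨δ, hδ, hδ'⟩ := Metric.eventually_nhds_iff_ball.1 h1
  obtain ⟨N, hN⟩ := eventually_atTop.1 (hφ.eventually (gt_mem_nhds hδ))
  refine ⟨N, fun i hi => ?_⟩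
  have hri := hN i hi
  set ψ := (φ i).normed μ with hψ
  have hψc : Continuous ψ := (φ i).continuous_normed
  have hψi : ∫⁻ t, ‖ψ t‖ₑ ∂μ = 1 := by
    have := ofReal_integral_eq_lintegral_ofReal ((φ i).integrable_normed (μ := μ))
      (Eventually.of_forall fun x => (φ i).nonneg_normed x)
    rw [(φ i).integral_normed] at this
    rw [← ENNReal.ofReal_one, this]
    exact lintegral_congr fun x => Real.enorm_of_nonneg ((φ i).nonneg_normed x)
  -- Since the kernel has mass one, the difference is an average of f(x - t) - f(x). After Tonelli
  -- only the t in the support of the kernel matter, and there ‖t‖ < δ.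
  have hpt : ∀ x, ‖(ψ ⋆[ContinuousLinearMap.lsmul ℝ ℝ, μ] f) x - f x‖ₑ
      ≤ ∫⁻ t, ‖ψ t‖ₑ * ‖f (x - t) - f x‖ₑ ∂μ := by
    intro x
    have he : ConvolutionExistsAt ψ f x (ContinuousLinearMap.lsmul ℝ ℝ) μ :=
      (φ i).hasCompactSupport_normed.convolutionExists_left _ hψc hf.locallyIntegrable x
    have h3 : f x = ∫ t, ψ t • f x ∂μ := by
      rw [integral_smul_const, (φ i).integral_normed, one_smul]
    have h4 : (ψ ⋆[ContinuousLinearMap.lsmul ℝ ℝ, μ] f) x - f x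
        = ∫ t, ψ t • (f (x - t) - f x) ∂μ := by
      conv_lhs => rw [h3]
      rw [convolution_def, ← integral_sub he ((φ i).integrable_normed.smul_const _)]
      simp [smul_sub, hψ]
    rw [h4]
    refine (enorm_integral_le_lintegral_enorm _).trans (le_of_eq ?_)
    simp [enorm_smul]
  calc ∫⁻ x, ‖(ψ ⋆[ContinuousLinearMap.lsmul ℝ ℝ, μ] f) x - f x‖ₑ ∂μ
      ≤ ∫⁻ x, ∫⁻ t, ‖ψ t‖ₑ * ‖f (x - t) - f x‖ₑ ∂μ ∂μ := lintegral_mono hpt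
    _ = ∫⁻ t, ∫⁻ x, ‖ψ t‖ₑ * ‖f (x - t) - f x‖ₑ ∂μ ∂μ := by
        refine lintegral_lintegral_swap ?_
        have h5 : AEStronglyMeasurable (fun z : E × E => f (z.1 - z.2)) (μ.prod μ) :=
          hf.1.comp_quasiMeasurePreserving
            (quasiMeasurePreserving_sub_of_right_invariant μ μ)
        have h6 : AEStronglyMeasurable (fun z : E × E => f z.1) (μ.prod μ) := hf.1.comp_fst
        exact (hψc.comp continuous_snd).enorm.aemeasurable.mul (h5.sub h6).enorm
    _ ≤ ∫⁻ t, ‖ψ t‖ₑ * ε ∂μ := by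
        refine lintegral_mono fun t => ?_
        have : ∫⁻ x, ‖ψ t‖ₑ * ‖f (x - t) - f x‖ₑ ∂μ
            = ‖ψ t‖ₑ * ∫⁻ x, ‖f (-t + x) - f x‖ₑ ∂μ := by
          rw [← lintegral_const_mul' _ _ enorm_ne_top]
          refine lintegral_congr fun x => ?_
          rw [neg_add_eq_sub]
        rw [this]
        by_cases ht : ψ t = 0
        · simp [ht]
        · gcongr
          apply hδ'
          have : t ∈ Function.support ψ := ht
          rw [hψ, (φ i).support_normed_eq] at this
          simp only [Metric.mem_ball, dist_zero_right, norm_neg] at this ⊢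
          exact this.trans hri
    _ = ε := by rw [lintegral_mul_const _ hψc.enorm.measurable, hψi, one_mul]

/-- The directional derivatives of the mollification of a weakly differentiable function. -/
theorem fderiv_convolution_apply {n : ℕ} {Ω U : Set (Eucl n)} {u : Eucl n → ℝ}
    {Du : Eucl n → Eucl n} (h : HasWeakGradient Ω u Du) (hU : IsCompact U) (hUΩ : U ⊆ Ω)
    (φ : ContDiffBump (0 : Eucl n)) {x : Eucl n} (hx : Metric.closedBall x φ.rOut ⊆ U) :
    fderiv ℝ (φ.normed volume ⋆[ContinuousLinearMap.lsmul ℝ ℝ, volume] U.indicator u) x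
      = innerSL ℝ ((φ.normed volume ⋆[ContinuousLinearMap.lsmul ℝ ℝ, volume] U.indicator Du) x) := by
  set ψ := φ.normed (volume : Measure (Eucl n)) with hψ
  have hUm : MeasurableSet U := hU.measurableSet
  have hui : Integrable (U.indicator u) volume :=
    (integrable_indicator_iff hUm).2 (h.locallyIntegrableOn.integrableOn_compact_subset hUΩ hU)
  have hDi : Integrable (U.indicator Du) volume :=
    (integrable_indicator_iff hUm).2
      (h.locallyIntegrableOn_grad.integrableOn_compact_subset hUΩ hU)
  have hψd : ContDiff ℝ ∞ ψ := φ.contDiff_normed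
  have hψd1 : ContDiff ℝ 1 ψ := φ.contDiff_normed (n := 1)
  have hψs : HasCompactSupport ψ := φ.hasCompactSupport_normed
  have hts : tsupport (fun y => ψ (x - y)) ⊆ Metric.closedBall x φ.rOut := by
    refine closure_minimal (fun y hy => ?_) Metric.isClosed_closedBall
    have : x - y ∈ Function.support ψ := hy
    rw [hψ, φ.support_normed_eq] at this
    rw [Metric.mem_closedBall, dist_comm, dist_eq_norm]
    simpa using (Metric.mem_ball.1 this).le
  have hcs : HasCompactSupport (fun y => ψ (x - y)) :=
    (isCompact_closedBall x φ.rOut).of_isClosed_subset (isClosed_tsupport _) hts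
  have hfd : ∀ y, fderiv ℝ (fun y => ψ (x - y)) y = -fderiv ℝ ψ (x - y) := by
    intro y
    have h1 : HasFDerivAt ψ (fderiv ℝ ψ (x - y)) (x - y) :=
      (hψd1.differentiable one_ne_zero).differentiableAt.hasFDerivAt
    have h2 : HasFDerivAt (fun y => x - y) (-ContinuousLinearMap.id ℝ (Eucl n)) y :=
      (hasFDerivAt_id y).const_sub x
    have := (h1.comp y h2).fderiv
    rw [show (fun y => ψ (x - y)) = ψ ∘ fun y => x - y from rfl, this]
    ext e; simp
  have h0 : ∀ y, y ∉ U → ψ (x - y) = 0 := fun y hy => by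
    by_contra hne
    exact hy (hx (hts (subset_tsupport (fun y => ψ (x - y)) hne)))
  have h0' : ∀ y, y ∉ U → fderiv ℝ (fun y => ψ (x - y)) y = 0 := fun y hy => by
    by_contra hne
    exact hy (hx (hts (support_fderiv_subset ℝ hne)))
  ext e
  rw [(hψs.hasFDerivAt_convolution_left _ hψd1 hui.locallyIntegrable x).fderiv]
  have hc1 : ConvolutionExistsAt (fderiv ℝ ψ) (U.indicator u) x
      ((ContinuousLinearMap.lsmul ℝ ℝ).precompL (Eucl n)) volume :=
    (hψs.fderiv ℝ).convolutionExists_left _ (hψd1.continuous_fderiv one_ne_zero)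
      hui.locallyIntegrable x
  have hc2 : ConvolutionExistsAt ψ (U.indicator Du) x (ContinuousLinearMap.lsmul ℝ ℝ) volume :=
    hψs.convolutionExists_left _ hψd1.continuous hDi.locallyIntegrable x
  -- The test function is the reflected kernel, supported in the ball about x that lies in U; hence
  -- the extension by zero off U is not felt. The sign from the reflection cancels the one from
  -- integration by parts.
  have hw := h.integral_eq (fun y => ψ (x - y)) (hψd.comp (contDiff_const.sub contDiff_id)) hcs
    (hts.trans (hx.trans hUΩ)) e
  have h1 : ((fderiv ℝ ψ ⋆[(ContinuousLinearMap.lsmul ℝ ℝ).precompL (Eucl n), volume]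
      U.indicator u) x) e = -∫ y in Ω, u y * fderiv ℝ (fun y => ψ (x - y)) y e := by
    rw [convolution_def, ContinuousLinearMap.integral_apply hc1,
      ← integral_sub_left_eq_self _ volume x,
      setIntegral_eq_integral_of_forall_compl_eq_zero, ← integral_neg]
    · refine integral_congr_ae (Eventually.of_forall fun y => ?_)
      by_cases hy : y ∈ U
      · simp [hfd, hy, ContinuousLinearMap.precompL_apply, mul_comm]
      · simp only [h0' y hy]
        simp [hy]
    · intro y hy
      simp [h0' y fun hy' => hy (hUΩ hy')]
  have h2 : inner ℝ ((ψ ⋆[ContinuousLinearMap.lsmul ℝ ℝ, volume] U.indicator Du) x) e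
      = ∫ y in Ω, inner ℝ (Du y) e * ψ (x - y) := by
    rw [convolution_def, real_inner_comm, ← integral_inner hc2,
      ← integral_sub_left_eq_self _ volume x,
      setIntegral_eq_integral_of_forall_compl_eq_zero]
    · refine integral_congr_ae (Eventually.of_forall fun y => ?_)
      by_cases hy : y ∈ U
      · simp [hy, inner_smul_right, real_inner_comm, mul_comm]
      · simp [hy, h0 y hy]
    · intro y hy
      simp [h0 y fun hy' => hy (hUΩ hy')]
  rw [h1, hw, neg_neg, ← h2, innerSL_apply_apply]

/-- Weakly differentiable functions are locally approximated by smooth functions, almost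
everywhere and with `L¹` convergence of the gradients. -/
theorem exists_smooth_approx {n : ℕ} {Ω : Set (Eucl n)} {u : Eucl n → ℝ}
    {Du : Eucl n → Eucl n} (h : HasWeakGradient Ω u Du) {x₀ : Eucl n} {ρ ρ' : ℝ} (hρ : ρ < ρ')
    (hΩ : Metric.closedBall x₀ ρ' ⊆ Ω) :
    ∃ v : ℕ → Eucl n → ℝ, (∀ i, ContDiff ℝ ∞ (v i)) ∧
      (∀ᵐ x ∂volume.restrict (Metric.ball x₀ ρ), Tendsto (fun i => v i x) atTop (𝓝 (u x))) ∧
      Tendsto (fun i => ∫⁻ x in Metric.ball x₀ ρ, ‖fderiv ℝ (v i) x - innerSL ℝ (Du x)‖ₑ)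
        atTop (𝓝 0) := by
  set U := Metric.closedBall x₀ ρ' with hU
  have hUc : IsCompact U := isCompact_closedBall _ _
  have hUm : MeasurableSet U := hUc.measurableSet
  have hui : Integrable (U.indicator u) volume :=
    (integrable_indicator_iff hUm).2 (h.locallyIntegrableOn.integrableOn_compact_subset hΩ hUc)
  have hDi : Integrable (U.indicator Du) volume :=
    (integrable_indicator_iff hUm).2
      (h.locallyIntegrableOn_grad.integrableOn_compact_subset hΩ hUc)
  set δ := ρ' - ρ with hδ
  have hδ0 : 0 < δ := sub_pos.2 hρ
  -- Outer radii at most δ keep the kernels centred in the small ball inside U. The fixed ratio 2 of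
  -- the radii is what the Lebesgue differentiation argument for a.e. convergence requires.
  let φ : ℕ → ContDiffBump (0 : Eucl n) := fun i =>
    ⟨δ / (i + 1) / 2, δ / (i + 1), by positivity, half_lt_self (by positivity)⟩
  have hφ0 : Tendsto (fun i => (φ i).rOut) atTop (𝓝 0) := by
    have := (tendsto_one_div_add_atTop_nhds_zero_nat (𝕜 := ℝ)).const_mul δ
    simpa [φ, div_eq_mul_inv] using this
  have hφle : ∀ i, (φ i).rOut ≤ δ := fun i => by
    change δ / (i + 1) ≤ δ
    exact div_le_self hδ0.le (by simp)
  have hsub : Metric.ball x₀ ρ ⊆ U :=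
    Metric.ball_subset_closedBall.trans (Metric.closedBall_subset_closedBall hρ.le)
  refine ⟨fun i => (φ i).normed volume ⋆[ContinuousLinearMap.lsmul ℝ ℝ, volume] U.indicator u,
    fun i => (φ i).hasCompactSupport_normed.contDiff_convolution_left _ (φ i).contDiff_normed
      hui.locallyIntegrable, ?_, ?_⟩
  · have := ContDiffBump.ae_convolution_tendsto_right_of_locallyIntegrable (K := 2) hφ0
      (Eventually.of_forall fun i => by simp only [φ]; linarith) hui.locallyIntegrable
    rw [ae_restrict_iff' measurableSet_ball]
    filter_upwards [this] with x hx hxB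
    rwa [indicator_of_mem (hsub hxB)] at hx
  · refine tendsto_of_tendsto_of_tendsto_of_le_of_le tendsto_const_nhds
      (tendsto_lintegral_convolution_sub hDi φ hφ0) (fun _ => zero_le) fun i => ?_
    refine le_trans (le_of_eq ?_) (setLIntegral_le_lintegral (Metric.ball x₀ ρ) _)
    refine setLIntegral_congr_fun measurableSet_ball fun x hx => ?_
    have hx' : Metric.closedBall x (φ i).rOut ⊆ U := by
      refine Metric.closedBall_subset_closedBall' ?_
      have := hφle i
      have := Metric.mem_ball.1 hx
      linarith
    change ‖fderiv ℝ _ x - _‖ₑ = _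
    rw [fderiv_convolution_apply h hUc hΩ (φ i) hx', indicator_of_mem (hsub hx), ← map_sub]
    rw [← ofReal_norm, ← ofReal_norm, innerSL_apply_norm]

/-! ### Cutoff functions with nearly optimal slope -/

/-- Smooth decreasing steps on the line, with a nearly optimal bound of the derivative. -/
theorem exists_smooth_step {a b κ : ℝ} (hab : a < b) (hκ : 1 < κ) :
    ∃ h : ℝ → ℝ, ContDiff ℝ ∞ h ∧ (∀ t, 0 ≤ h t) ∧ (∀ t, h t ≤ 1) ∧ (∀ t ≤ a, h t = 1) ∧
      (∃ b' < b, ∀ t, b' ≤ t → h t = 0) ∧ ∀ t, |deriv h t| ≤ κ / (b - a) := by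
  have hw : 0 < (b - a) / 2 := by linarith
  have hr : (b - a) / 2 / κ < (b - a) / 2 := div_lt_self hw hκ
  obtain ⟨s, hs1, hs2⟩ := exists_between hr
  -- The step is one minus the primitive of a normalized bump ψ. As ψ is at most the inverse length
  -- of its inner interval, the inner radius (b - a)/(2κ) gives the slope κ/(b - a). The constant κ
  -- of the class may be arbitrarily close to 1, so a cruder bound would not do.
  let f : ContDiffBump ((a + b) / 2) := ⟨(b - a) / 2 / κ, s, by positivity, hs1⟩
  set ψ := f.normed volume with hψ
  have hψ0 : ∀ t, 0 ≤ ψ t := f.nonneg_normed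
  have hψc : Continuous ψ := f.continuous_normed
  have hψi : Integrable ψ volume := f.integrable_normed
  have hψ1 : ∫ t, ψ t = 1 := f.integral_normed
  have hsupp : ∀ t, ψ t ≠ 0 → a < t ∧ t < (a + b) / 2 + s := by
    intro t ht
    have : t ∈ Function.support ψ := ht
    rw [hψ, f.support_normed_eq, Metric.mem_ball, Real.dist_eq, abs_lt] at this
    constructor
    · have : -s < t - (a + b) / 2 := this.1
      linarith
    · have : t - (a + b) / 2 < s := this.2
      linarith
  have hd : ∀ t, HasDerivAt (fun t => 1 - ∫ x in a..t, ψ x) (-ψ t) t := fun t =>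
    ((hψc.integral_hasStrictDerivAt a t).hasDerivAt.const_sub 1)
  have hderiv : deriv (fun t => 1 - ∫ x in a..t, ψ x) = fun t => -ψ t := funext fun t => (hd t).deriv
  have hlow : ∀ t ≤ a, (∫ x in a..t, ψ x) = 0 := by
    intro t ht
    rw [intervalIntegral.integral_symm, intervalIntegral.integral_of_le ht, neg_eq_zero]
    refine setIntegral_eq_zero_of_forall_eq_zero fun x hx => ?_
    by_contra hne
    exact absurd (hsupp x hne).1 (not_lt.2 hx.2)
  have hle1 : ∀ t, (∫ x in a..t, ψ x) ≤ 1 := by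
    intro t
    rcases le_total t a with ht | ht
    · rw [hlow t ht]; exact zero_le_one
    · rw [intervalIntegral.integral_of_le ht, ← hψ1]
      exact setIntegral_le_integral hψi (Eventually.of_forall hψ0)
  have hge0 : ∀ t, 0 ≤ (∫ x in a..t, ψ x) := by
    intro t
    rcases le_total t a with ht | ht
    · rw [hlow t ht]
    · exact intervalIntegral.integral_nonneg ht fun x _ => hψ0 x
  refine ⟨fun t => 1 - ∫ x in a..t, ψ x, ?_, fun t => by linarith [hle1 t],
    fun t => by linarith [hge0 t], fun t ht => by simp [hlow t ht],
    ⟨(a + b) / 2 + s, by linarith, fun t ht => ?_⟩, fun t => ?_⟩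
  · rw [contDiff_infty_iff_deriv, hderiv]
    exact ⟨fun t => (hd t).differentiableAt, f.contDiff_normed.neg⟩
  · have hs0 : 0 < s := f.rOut_pos
    have hat : a ≤ t := by linarith
    have : (∫ x in a..t, ψ x) = 1 := by
      rw [intervalIntegral.integral_of_le hat, ← hψ1]
      refine setIntegral_eq_integral_of_forall_compl_eq_zero fun x hx => ?_
      by_contra hne
      exact hx ⟨(hsupp x hne).1, (hsupp x hne).2.le.trans ht⟩
    change 1 - (∫ x in a..t, ψ x) = 0
    linarith
  · rw [hderiv]
    simp only [abs_neg, abs_of_nonneg (hψ0 t)]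
    refine (f.normed_le_div_measure_closedBall_rIn _ t).trans (le_of_eq ?_)
    rw [measureReal_def, Real.volume_closedBall, ENNReal.toReal_ofReal (by
      have := f.rIn_pos
      positivity)]
    change 1 / (2 * ((b - a) / 2 / κ)) = _
    field_simp

/-- Smooth cutoff functions between concentric balls, with a nearly optimal gradient bound. -/
theorem exists_isCutoff {n : ℕ} (y : Eucl n) {κ r σ : ℝ} (hκ : 1 < κ) (hr : 0 < r) (hσ : 0 < σ)
    (hσ1 : σ < 1) : ∃ ζ : Eucl n → ℝ, IsCutoff κ y r σ ζ := by
  have ha : 0 < r * (1 - σ) := mul_pos hr (by linarith)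
  have hb : 0 < σ * r := mul_pos hσ hr
  obtain ⟨h, hc, h0, h1, hlow, ⟨b', hb', hhigh⟩, hder⟩ :=
    exists_smooth_step (a := r * (1 - σ)) (b := r) (by linarith) hκ
  have hts : tsupport (fun x => h (dist x y)) ⊆ Metric.closedBall y b' := by
    refine closure_minimal (fun x hx => ?_) Metric.isClosed_closedBall
    by_contra hne
    exact hx (hhigh _ (not_le.1 hne).le)
  -- The distance is not smooth at the centre, but there the cutoff is locally constant.
  have hev : ∀ x ∈ Metric.ball y (r * (1 - σ)), (fun x => h (dist x y)) =ᶠ[𝓝 x] fun _ => 1 :=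
    fun x hx => by
      filter_upwards [Metric.isOpen_ball.mem_nhds hx] with z hz
      exact hlow _ (Metric.mem_ball.1 hz).le
  have hne : ∀ x, x ∉ Metric.ball y (r * (1 - σ)) → x - y ≠ 0 := by
    rintro x hx h
    rw [sub_eq_zero] at h
    exact hx (by simpa [h] using ha)
  refine ⟨fun x => h (dist x y), ?_, ?_, ?_, fun x => h0 _, fun x => h1 _,
    fun x hx => hlow _ (Metric.mem_ball.1 hx).le, fun x => ?_⟩
  · rw [contDiff_iff_contDiffAt]
    intro x
    by_cases hx : x ∈ Metric.ball y (r * (1 - σ))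
    · exact contDiffAt_const.congr_of_eventuallyEq (hev x hx)
    · simp only [dist_eq_norm]
      exact hc.contDiffAt.comp x
        ((contDiffAt_norm ℝ (hne x hx)).comp x (contDiffAt_id.sub contDiffAt_const))
  · exact (isCompact_closedBall y b').of_isClosed_subset (isClosed_tsupport _) hts
  · exact hts.trans (Metric.closedBall_subset_ball hb')
  · by_cases hx : x ∈ Metric.ball y (r * (1 - σ))
    · rw [(hev x hx).fderiv_eq, fderiv_fun_const]
      simp only [Pi.zero_apply, norm_zero]
      positivity
    · simp only [dist_eq_norm]
      have h2 : DifferentiableAt ℝ (fun x => ‖x - y‖) x :=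
        ((contDiffAt_norm ℝ (hne x hx)).differentiableAt one_ne_zero).comp x
          (differentiableAt_id.sub_const y)
      have h3 : HasDerivAt h (deriv h ‖x - y‖) ‖x - y‖ :=
        (hc.differentiable (by simp)).differentiableAt.hasDerivAt
      have h4 : HasFDerivAt (fun x => h ‖x - y‖) (deriv h ‖x - y‖ • fderiv ℝ (fun x => ‖x - y‖) x) x :=
        h3.comp_hasFDerivAt x h2.hasFDerivAt
      rw [h4.fderiv, norm_smul]
      have h5 : ‖fderiv ℝ (fun x => ‖x - y‖) x‖ ≤ 1 := by
        have : LipschitzWith 1 (fun x : Eucl n => ‖x - y‖) := by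
          simpa [dist_eq_norm] using LipschitzWith.dist_left y
        simpa using norm_fderiv_le_of_lipschitz ℝ this
      calc ‖deriv h ‖x - y‖‖ * _ ≤ (κ / (r - r * (1 - σ))) * 1 :=
            mul_le_mul (hder _) h5 (norm_nonneg _) (by
              have : r - r * (1 - σ) = σ * r := by ring
              rw [this]; positivity)
        _ = _ := by
            rw [mul_one, div_eq_mul_inv]
            congr 2
            ring

/-! ### The Poincaré inequality for smooth functions on a ball -/

/-- Averaging a function over the points `(1 - t) y + t x` of a ball, for `t` away from `0`. -/
theorem setLIntegral_comp_lineMap_le {n : ℕ} {x₀ : Eucl n} {ρ t : ℝ} (ht : 1 / 2 ≤ t)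
    (ht1 : t ≤ 1) {y : Eucl n} (hy : y ∈ Metric.ball x₀ ρ) {f : Eucl n → ℝ≥0∞} (hf : Measurable f) :
    ∫⁻ x in Metric.ball x₀ ρ, f ((1 - t) • y + t • x) ≤ 2 ^ n * ∫⁻ z in Metric.ball x₀ ρ, f z := by
  have ht0 : t ≠ 0 := by linarith
  set B := Metric.ball x₀ ρ
  have hB : ∀ x ∈ B, (1 - t) • y + t • x ∈ B := fun x hx =>
    (convex_ball x₀ ρ) hy hx (by linarith) (by linarith) (by ring)
  have hBm : MeasurableSet B := measurableSet_ball
  -- The change of variables costs the Jacobian factor t⁻ⁿ, which is at most 2ⁿ for t ≥ 1/2;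
  -- convexity keeps the image of B inside B.
  have hmap : ∫⁻ x, B.indicator f ((1 - t) • y + t • x)
      = ENNReal.ofReal |(t ^ n)⁻¹| * ∫⁻ z, B.indicator f z := by
    have h1 : ∫⁻ x, B.indicator f ((1 - t) • y + t • x)
        = ∫⁻ z, B.indicator f ((1 - t) • y + z) ∂(Measure.map (t • ·) volume) :=
      (lintegral_map ((hf.indicator hBm).comp (measurable_const_add _))
        (measurable_const_smul t)).symm
    rw [h1, Measure.map_addHaar_smul _ ht0, lintegral_smul_measure,
      lintegral_add_left_eq_self (fun z => B.indicator f z)]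
    simp
  calc ∫⁻ x in B, f ((1 - t) • y + t • x)
      = ∫⁻ x in B, B.indicator f ((1 - t) • y + t • x) :=
        setLIntegral_congr_fun hBm fun x hx => (indicator_of_mem (hB x hx) f).symm
    _ ≤ ∫⁻ x, B.indicator f ((1 - t) • y + t • x) := setLIntegral_le_lintegral _ _
    _ = ENNReal.ofReal |(t ^ n)⁻¹| * ∫⁻ z in B, f z := by rw [hmap, lintegral_indicator hBm]
    _ ≤ 2 ^ n * ∫⁻ z in B, f z := by
        gcongr
        have : |(t ^ n)⁻¹| ≤ 2 ^ n := by
          rw [abs_of_nonneg (by positivity), ← inv_pow]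
          gcongr
          rw [inv_le_comm₀ (by linarith) two_pos]
          linarith
        refine (ENNReal.ofReal_le_ofReal this).trans (le_of_eq ?_)
        rw [ENNReal.ofReal_pow two_pos.le]
        simp

/-- The mean value inequality on a segment, in integral form. -/
theorem enorm_sub_le_lintegral_fderiv {n : ℕ} {v : Eucl n → ℝ} (hv : ContDiff ℝ 1 v)
    (x y : Eucl n) : ‖v x - v y‖ₑ
      ≤ ‖x - y‖ₑ * ∫⁻ t in Icc (0 : ℝ) 1, ‖fderiv ℝ v ((1 - t) • y + t • x)‖ₑ := by
  have hγ : ∀ t : ℝ, HasDerivAt (fun t : ℝ => (1 - t) • y + t • x) (x - y) t := by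
    intro t
    have h1 : HasDerivAt (fun t : ℝ => (1 - t) • y) ((-1 : ℝ) • y) t :=
      ((hasDerivAt_id t).const_sub 1).smul_const y
    have h2 : HasDerivAt (fun t : ℝ => t • x) ((1 : ℝ) • x) t := (hasDerivAt_id t).smul_const x
    have h3 := h1.add h2
    rwa [neg_one_smul, one_smul, neg_add_eq_sub] at h3
  have hcont : Continuous fun t : ℝ => fderiv ℝ v ((1 - t) • y + t • x) :=
    (hv.continuous_fderiv one_ne_zero).comp (by fun_prop)
  have hd : ∀ t : ℝ, HasDerivAt (fun t : ℝ => v ((1 - t) • y + t • x))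
      (fderiv ℝ v ((1 - t) • y + t • x) (x - y)) t := fun t =>
    ((hv.differentiable one_ne_zero).differentiableAt.hasFDerivAt).comp_hasDerivAt t (hγ t)
  have hftc : ∫ t in (0 : ℝ)..1, fderiv ℝ v ((1 - t) • y + t • x) (x - y) = v x - v y := by
    rw [intervalIntegral.integral_eq_sub_of_hasDerivAt (fun t _ => hd t)
      ((hcont.clm_apply continuous_const).intervalIntegrable _ _)]
    simp
  rw [← hftc, intervalIntegral.integral_of_le zero_le_one, ← integral_Icc_eq_integral_Ioc,
    ← lintegral_const_mul _ hcont.enorm.measurable]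
  refine (enorm_integral_le_lintegral_enorm _).trans (lintegral_mono fun t => ?_)
  rw [mul_comm]
  exact ContinuousLinearMap.le_opENorm _ _

/-- The Poincaré inequality on a ball, in double integral form. -/
theorem lintegral_lintegral_enorm_sub_le {n : ℕ} {v : Eucl n → ℝ} (hv : ContDiff ℝ 1 v)
    (x₀ : Eucl n) (ρ : ℝ) :
    ∫⁻ x in Metric.ball x₀ ρ, ∫⁻ y in Metric.ball x₀ ρ, ‖v x - v y‖ₑ ≤
      ENNReal.ofReal (2 * ρ) * 2 ^ n * volume (Metric.ball x₀ ρ) *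
        ∫⁻ x in Metric.ball x₀ ρ, ‖fderiv ℝ v x‖ₑ := by
  set B := Metric.ball x₀ ρ
  have hBm : MeasurableSet B := measurableSet_ball
  set F : Eucl n → ℝ≥0∞ := fun z => ‖fderiv ℝ v z‖ₑ with hF
  have hFc : Continuous F := (hv.continuous_fderiv one_ne_zero).enorm
  have hpt : ∀ x ∈ B, ∀ y ∈ B, ‖v x - v y‖ₑ
      ≤ ENNReal.ofReal (2 * ρ) * ∫⁻ t in Icc (0 : ℝ) 1, F ((1 - t) • y + t • x) := by
    intro x hx y hy
    refine (enorm_sub_le_lintegral_fderiv hv x y).trans ?_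
    gcongr
    rw [← ofReal_norm]
    refine ENNReal.ofReal_le_ofReal ?_
    rw [← dist_eq_norm]
    have h1 := dist_triangle_right x y x₀
    have h2 := Metric.mem_ball.1 hx
    have h3 := Metric.mem_ball.1 hy
    linarith
  have hm3 : Measurable fun p : (Eucl n × Eucl n) × ℝ => F ((1 - p.2) • p.1.2 + p.2 • p.1.1) :=
    (hFc.comp (by fun_prop)).measurable
  calc ∫⁻ x in B, ∫⁻ y in B, ‖v x - v y‖ₑ
      ≤ ∫⁻ x in B, ∫⁻ y in B,
          ENNReal.ofReal (2 * ρ) * ∫⁻ t in Icc (0 : ℝ) 1, F ((1 - t) • y + t • x) :=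
        setLIntegral_mono' hBm fun x hx => setLIntegral_mono' hBm fun y hy => hpt x hx y hy
    _ = ENNReal.ofReal (2 * ρ) * ∫⁻ x in B, ∫⁻ y in B,
          ∫⁻ t in Icc (0 : ℝ) 1, F ((1 - t) • y + t • x) := by
        rw [← lintegral_const_mul' _ _ ENNReal.ofReal_ne_top]
        refine lintegral_congr fun x => ?_
        rw [lintegral_const_mul' _ _ ENNReal.ofReal_ne_top]
    _ = ENNReal.ofReal (2 * ρ) * ∫⁻ t in Icc (0 : ℝ) 1, ∫⁻ x in B, ∫⁻ y in B,
          F ((1 - t) • y + t • x) := by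
        congr 1
        rw [lintegral_lintegral_swap (f := fun t x => ∫⁻ y in B, F ((1 - t) • y + t • x))]
        · refine lintegral_congr fun x => ?_
          rw [lintegral_lintegral_swap]
          exact (hm3.comp (f := fun p : Eucl n × ℝ => ((x, p.1), p.2)) (by fun_prop)).aemeasurable
        · refine Measurable.aemeasurable ?_
          exact (hm3.comp (f := fun p : (ℝ × Eucl n) × Eucl n => ((p.1.2, p.2), p.1.1))
            (by fun_prop)).lintegral_prod_right'
    _ ≤ ENNReal.ofReal (2 * ρ) * ∫⁻ t in Icc (0 : ℝ) 1, 2 ^ n * volume B * ∫⁻ z in B, F z := by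
        gcongr ENNReal.ofReal (2 * ρ) * ?_
        refine setLIntegral_mono' measurableSet_Icc fun t ht => ?_
        -- For t ≥ 1/2 the substitution is made in x with y fixed, for t ≤ 1/2 in y with x fixed; so
        -- the Jacobian never degenerates.
        rcases le_total (1 / 2) t with h | h
        · rw [lintegral_lintegral_swap]
          · refine (setLIntegral_mono' hBm fun y hy =>
              setLIntegral_comp_lineMap_le h ht.2 hy hFc.measurable).trans (le_of_eq ?_)
            rw [lintegral_const, Measure.restrict_apply_univ]
            ring
          · exact (hm3.comp (f := fun p : Eucl n × Eucl n => ((p.1, p.2), t))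
              (by fun_prop)).aemeasurable
        · have hs : ∀ x ∈ B, ∫⁻ y in B, F ((1 - t) • y + t • x) ≤ 2 ^ n * ∫⁻ z in B, F z := by
            intro x hx
            have := setLIntegral_comp_lineMap_le (t := 1 - t) (by linarith) (by linarith [ht.1]) hx
              hFc.measurable
            simpa [add_comm] using this
          refine (setLIntegral_mono' hBm hs).trans (le_of_eq ?_)
          rw [lintegral_const, Measure.restrict_apply_univ]
          ring
    _ = _ := by
        rw [lintegral_const, Measure.restrict_apply_univ, Real.volume_Icc]
        simp
        ring

/-! ### Smooth truncation between two levels -/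

theorem deriv_smoothTransition_eq_zero {t : ℝ} (ht : t ∉ Ioo (0 : ℝ) 1) :
    deriv Real.smoothTransition t = 0 := by
  rcases le_or_gt t 0 with h | h
  · refine IsLocalMin.deriv_eq_zero (Eventually.of_forall fun s => ?_)
    rw [Real.smoothTransition.zero_of_nonpos h]
    exact Real.smoothTransition.nonneg s
  · have h1 : 1 ≤ t := by
      by_contra hlt
      exact ht ⟨h, not_le.1 hlt⟩
    refine IsLocalMax.deriv_eq_zero (Eventually.of_forall fun s => ?_)
    rw [Real.smoothTransition.one_of_one_le h1]
    exact Real.smoothTransition.le_one s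

theorem continuous_deriv_smoothTransition : Continuous (deriv Real.smoothTransition) :=
  (Real.smoothTransition.contDiff (n := 1)).continuous_deriv_one

theorem exists_abs_deriv_smoothTransition_le :
    ∃ L : ℝ, 0 < L ∧ ∀ t, |deriv Real.smoothTransition t| ≤ L := by
  obtain ⟨C, hC⟩ := (isCompact_Icc (a := (0 : ℝ)) (b := 1)).exists_bound_of_continuousOn
    continuous_deriv_smoothTransition.continuousOn
  refine ⟨max C 1, by positivity, fun t => ?_⟩
  by_cases ht : t ∈ Ioo (0 : ℝ) 1
  · exact (hC t (Ioo_subset_Icc_self ht)).trans (le_max_left _ _)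
  · rw [deriv_smoothTransition_eq_zero ht, abs_zero]
    positivity

/-- A bound for the derivative of `Real.smoothTransition`. -/
def transitionBound : ℝ := exists_abs_deriv_smoothTransition_le.choose

theorem transitionBound_pos : 0 < transitionBound :=
  exists_abs_deriv_smoothTransition_le.choose_spec.1

/-- A smooth increasing function that is `0` below `k` and `1` above `l`. -/
def levelStep (k l t : ℝ) : ℝ := Real.smoothTransition ((t - k) / (l - k))

section levelStep
variable {k l : ℝ}

theorem contDiff_levelStep {n : ℕ∞} : ContDiff ℝ n (levelStep k l) :=
  Real.smoothTransition.contDiff.comp ((contDiff_id.sub contDiff_const).div_const _)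

theorem levelStep_nonneg (t : ℝ) : 0 ≤ levelStep k l t := Real.smoothTransition.nonneg _

theorem levelStep_le_one (t : ℝ) : levelStep k l t ≤ 1 := Real.smoothTransition.le_one _

theorem levelStep_eq_zero (h : k < l) {t : ℝ} (ht : t ≤ k) : levelStep k l t = 0 :=
  Real.smoothTransition.zero_of_nonpos
    (div_nonpos_of_nonpos_of_nonneg (sub_nonpos.2 ht) (sub_pos.2 h).le)

theorem levelStep_eq_one (h : k < l) {t : ℝ} (ht : l ≤ t) : levelStep k l t = 1 :=
  Real.smoothTransition.one_of_one_le ((one_le_div (sub_pos.2 h)).2 (by linarith))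

theorem hasDerivAt_levelStep (t : ℝ) : HasDerivAt (levelStep k l)
    (deriv Real.smoothTransition ((t - k) / (l - k)) * (1 / (l - k))) t := by
  have h1 : HasDerivAt Real.smoothTransition (deriv Real.smoothTransition ((t - k) / (l - k)))
      ((t - k) / (l - k)) :=
    ((Real.smoothTransition.contDiff (n := 1)).differentiable one_ne_zero).differentiableAt.hasDerivAt
  exact h1.comp t (((hasDerivAt_id t).sub_const k).div_const (l - k))

theorem deriv_levelStep (t : ℝ) : deriv (levelStep k l) t =
    deriv Real.smoothTransition ((t - k) / (l - k)) * (1 / (l - k)) := (hasDerivAt_levelStep t).deriv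

theorem continuous_deriv_levelStep : Continuous (deriv (levelStep k l)) :=
  (contDiff_levelStep (n := 1)).continuous_deriv_one

theorem enorm_deriv_levelStep_le (h : k < l) (t : ℝ) :
    ‖deriv (levelStep k l) t‖ₑ ≤ ENNReal.ofReal (transitionBound / (l - k)) := by
  rw [← ofReal_norm, deriv_levelStep, norm_mul, Real.norm_eq_abs, Real.norm_eq_abs,
    abs_of_pos (one_div_pos.2 (sub_pos.2 h)), mul_one_div]
  have := sub_pos.2 h
  gcongr
  exact exists_abs_deriv_smoothTransition_le.choose_spec.2 _

/-- This confines the gradient of a truncation to the strip between the levels, so that only the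
gradient of u on that strip enters the estimates. -/
theorem deriv_levelStep_eq_zero (h : k < l) {t : ℝ} (ht : ¬ (k < t ∧ t < l)) :
    deriv (levelStep k l) t = 0 := by
  rw [deriv_levelStep, deriv_smoothTransition_eq_zero, zero_mul]
  rintro ⟨h1, h2⟩
  have := sub_pos.2 h
  rw [div_lt_one this] at h2
  exact ht ⟨by linarith [(div_pos_iff_of_pos_right this).1 h1], by linarith⟩

end levelStep

/-- Smooth approximations of a truncation of a weakly differentiable function. -/
theorem exists_truncated_approx {n : ℕ} {Ω : Set (Eucl n)} {u : Eucl n → ℝ}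
    {Du : Eucl n → Eucl n} (h : HasWeakGradient Ω u Du) {x₀ : Eucl n} {ρ ρ' : ℝ} (hρ : ρ < ρ')
    (hΩ : Metric.closedBall x₀ ρ' ⊆ Ω) {k l : ℝ} (hkl : k < l) :
    ∃ (w : ℕ → Eucl n → ℝ) (b : ℕ → ℝ≥0∞) (c : ℝ≥0∞), (∀ i, ContDiff ℝ ∞ (w i)) ∧
      (∀ i x, 0 ≤ w i x) ∧ (∀ i x, w i x ≤ 1) ∧
      (∀ᵐ x ∂volume.restrict (Metric.ball x₀ ρ),
        Tendsto (fun i => w i x) atTop (𝓝 (levelStep k l (u x)))) ∧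
      (∀ i, ∫⁻ x in Metric.ball x₀ ρ, ‖fderiv ℝ (w i) x‖ₑ ≤ b i) ∧ Tendsto b atTop (𝓝 c) ∧
      c ≤ ENNReal.ofReal (transitionBound / (l - k)) *
        ∫⁻ x in Metric.ball x₀ ρ ∩ {x | k < u x ∧ u x < l}, ‖Du x‖ₑ := by
  obtain ⟨v, hv, hae, hL⟩ := exists_smooth_approx h hρ hΩ
  set B := Metric.ball x₀ ρ
  have hBm : MeasurableSet B := measurableSet_ball
  set K := ENNReal.ofReal (transitionBound / (l - k))
  have hDi : IntegrableOn Du B volume :=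
    (h.locallyIntegrableOn_grad.integrableOn_compact_subset hΩ (isCompact_closedBall _ _)).mono_set
      (Metric.ball_subset_closedBall.trans (Metric.closedBall_subset_closedBall hρ.le))
  have hfd : ∀ i x, fderiv ℝ (fun x => levelStep k l (v i x)) x
      = deriv (levelStep k l) (v i x) • fderiv ℝ (v i) x := fun i x => by
    have h1 : HasDerivAt (levelStep k l) (deriv (levelStep k l) (v i x)) (v i x) :=
      ((contDiff_levelStep (n := 1)).differentiable one_ne_zero).differentiableAt.hasDerivAt
    exact (h1.comp_hasFDerivAt x
      ((hv i).differentiable (by simp)).differentiableAt.hasFDerivAt).fderiv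
  -- The gradient of the truncated mollification is the derivative of the step times ∇vᵢ. Replacing
  -- ∇vᵢ by Du costs K times an L¹ distance tending to zero; the rest converges by domination by
  -- K‖Du‖. Thus the classical chain rule for the vᵢ suffices.
  refine ⟨fun i x => levelStep k l (v i x),
    fun i => (∫⁻ x in B, ‖deriv (levelStep k l) (v i x)‖ₑ * ‖Du x‖ₑ) +
      K * ∫⁻ x in B, ‖fderiv ℝ (v i) x - innerSL ℝ (Du x)‖ₑ,
    ∫⁻ x in B, ‖deriv (levelStep k l) (u x)‖ₑ * ‖Du x‖ₑ,
    fun i => contDiff_levelStep.comp (hv i), fun i x => levelStep_nonneg _,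
    fun i x => levelStep_le_one _, ?_, fun i => ?_, ?_, ?_⟩
  · filter_upwards [hae] with x hx
    exact ((contDiff_levelStep (n := 0)).continuous.tendsto _).comp hx
  · dsimp only
    rw [← lintegral_const_mul' _ _ ENNReal.ofReal_ne_top, ← lintegral_add_left']
    · refine lintegral_mono fun x => ?_
      change ‖fderiv ℝ (fun x => levelStep k l (v i x)) x‖ₑ ≤ _
      rw [hfd, enorm_smul]
      have h1 : ‖fderiv ℝ (v i) x‖ₑ ≤ ‖Du x‖ₑ + ‖fderiv ℝ (v i) x - innerSL ℝ (Du x)‖ₑ := by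
        have h2 : ‖innerSL ℝ (Du x)‖ₑ = ‖Du x‖ₑ := by
          rw [← ofReal_norm, ← ofReal_norm, innerSL_apply_norm]
        rw [← h2, ← ofReal_norm, ← ofReal_norm, ← ofReal_norm,
          ← ENNReal.ofReal_add (norm_nonneg _) (norm_nonneg _)]
        exact ENNReal.ofReal_le_ofReal (norm_le_norm_add_norm_sub' _ _)
      calc _ ≤ ‖deriv (levelStep k l) (v i x)‖ₑ *
            (‖Du x‖ₑ + ‖fderiv ℝ (v i) x - innerSL ℝ (Du x)‖ₑ) := by gcongr
        _ ≤ _ := by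
          rw [mul_add]
          gcongr
          exact enorm_deriv_levelStep_le hkl _
    · exact ((continuous_deriv_levelStep.comp (hv i).continuous).enorm.aemeasurable).mul
        hDi.1.enorm
  · have h1 : Tendsto (fun i => ∫⁻ x in B, ‖deriv (levelStep k l) (v i x)‖ₑ * ‖Du x‖ₑ) atTop
        (𝓝 (∫⁻ x in B, ‖deriv (levelStep k l) (u x)‖ₑ * ‖Du x‖ₑ)) := by
      refine tendsto_lintegral_of_dominated_convergence' (fun x => K * ‖Du x‖ₑ) (fun i => ?_)
        (fun i => Eventually.of_forall fun x => ?_) ?_ ?_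
      · exact ((continuous_deriv_levelStep.comp (hv i).continuous).enorm.aemeasurable).mul
          hDi.1.enorm
      · dsimp only
        gcongr
        exact enorm_deriv_levelStep_le hkl _
      · rw [lintegral_const_mul' _ _ ENNReal.ofReal_ne_top]
        exact ENNReal.mul_ne_top ENNReal.ofReal_ne_top hDi.2.ne
      · filter_upwards [hae] with x hx
        exact ENNReal.Tendsto.mul_const
          (((continuous_deriv_levelStep.enorm).tendsto _).comp hx) (Or.inr enorm_ne_top)
    have h2 := h1.add (ENNReal.Tendsto.const_mul (a := K) hL (Or.inr ENNReal.ofReal_ne_top))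
    simpa using h2
  · rw [inter_comm, ← Measure.restrict_restrict' hBm,
      ← lintegral_const_mul' _ _ ENNReal.ofReal_ne_top]
    refine le_trans (lintegral_mono fun x => ?_) (lintegral_indicator_le _ _)
    by_cases hx : k < u x ∧ u x < l
    · rw [indicator_of_mem (show x ∈ {x | k < u x ∧ u x < l} from hx)]
      gcongr
      exact enorm_deriv_levelStep_le hkl _
    · rw [deriv_levelStep_eq_zero hkl hx]
      simp

/-! ### Isoperimetric and Sobolev inequalities for level sets -/

/-- De Giorgi's isoperimetric inequality on a ball. -/
theorem volume_superlevel_mul_volume_sublevel_le {n : ℕ} {Ω : Set (Eucl n)} {u : Eucl n → ℝ}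
    {Du : Eucl n → Eucl n} (h : HasWeakGradient Ω u Du) (hum : Measurable u) {x₀ : Eucl n}
    {ρ ρ' : ℝ} (hρ : ρ < ρ') (hΩ : Metric.closedBall x₀ ρ' ⊆ Ω) {k l : ℝ} (hkl : k < l) :
    volume (Metric.ball x₀ ρ ∩ {x | l ≤ u x}) * volume (Metric.ball x₀ ρ ∩ {x | u x ≤ k}) ≤
      ENNReal.ofReal (2 * ρ) * 2 ^ n * volume (Metric.ball x₀ ρ) *
        (ENNReal.ofReal (transitionBound / (l - k)) *
          ∫⁻ x in Metric.ball x₀ ρ ∩ {x | k < u x ∧ u x < l}, ‖Du x‖ₑ) := by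
  obtain ⟨w, b, c, hw, -, -, hae, hb, hbc, hc⟩ := exists_truncated_approx h hρ hΩ hkl
  set B := Metric.ball x₀ ρ
  have hBm : MeasurableSet B := measurableSet_ball
  set θ : Eucl n → ℝ := fun x => levelStep k l (u x)
  set A := ENNReal.ofReal (2 * ρ) * 2 ^ n * volume B
  have hA : A ≠ ⊤ := ENNReal.mul_ne_top (ENNReal.mul_ne_top ENNReal.ofReal_ne_top (by simp))
    measure_ball_lt_top.ne
  have hwm : ∀ i, Measurable fun p : Eucl n × Eucl n => ‖w i p.1 - w i p.2‖ₑ := fun i =>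
    (((hw i).continuous.comp continuous_fst).sub
      ((hw i).continuous.comp continuous_snd)).enorm.measurable
  have hS : MeasurableSet {x | l ≤ u x} := measurableSet_le measurable_const hum
  have hT : MeasurableSet {x | u x ≤ k} := measurableSet_le hum measurable_const
  -- The truncation θ is 1 on the first set and 0 on the second, so the product of the measures is
  -- at most the double integral of |θ(x) - θ(y)|. Fatou's lemma, once in each variable, passes to
  -- the Poincaré inequality of the smooth approximations.
  calc volume (B ∩ {x | l ≤ u x}) * volume (B ∩ {x | u x ≤ k})
      = ∫⁻ _ in B ∩ {x | l ≤ u x}, ∫⁻ _ in B ∩ {x | u x ≤ k}, 1 := by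
        simp [mul_comm]
    _ ≤ ∫⁻ x in B ∩ {x | l ≤ u x}, ∫⁻ y in B ∩ {x | u x ≤ k}, ‖θ x - θ y‖ₑ := by
        refine setLIntegral_mono' (hBm.inter hS) fun x hx =>
          setLIntegral_mono' (hBm.inter hT) fun y hy => ?_
        simp only [θ]
        rw [levelStep_eq_one hkl hx.2, levelStep_eq_zero hkl hy.2]
        simp
    _ ≤ ∫⁻ x in B, ∫⁻ y in B, ‖θ x - θ y‖ₑ :=
        (lintegral_mono_set inter_subset_left).trans
          (lintegral_mono fun x => lintegral_mono_set inter_subset_left)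
    _ ≤ ∫⁻ x in B, liminf (fun i => ∫⁻ y in B, ‖w i x - w i y‖ₑ) atTop := by
        refine lintegral_mono_ae ?_
        filter_upwards [hae] with x hx
        refine le_trans (lintegral_mono_ae ?_) (lintegral_liminf_le fun i =>
          (hwm i).comp measurable_prodMk_left)
        filter_upwards [hae] with y hy
        exact ((hx.sub hy).enorm).liminf_eq.ge
    _ ≤ liminf (fun i => ∫⁻ x in B, ∫⁻ y in B, ‖w i x - w i y‖ₑ) atTop :=
        lintegral_liminf_le fun i => (hwm i).lintegral_prod_right'
    _ ≤ liminf (fun i => A * b i) atTop := by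
        refine liminf_le_liminf (Eventually.of_forall fun i => ?_)
        refine (lintegral_lintegral_enorm_sub_le ((hw i).of_le (by simp)) x₀ ρ).trans ?_
        gcongr
        exact hb i
    _ = A * c := (ENNReal.Tendsto.const_mul hbc (Or.inr hA)).liminf_eq
    _ ≤ _ := by gcongr

/-- The constant of the Gagliardo–Nirenberg–Sobolev inequality for `W^{1,1}`. -/
def sobolevConst (n : ℕ) : ℝ≥0∞ :=
  lintegralPowLePowLIntegralFDerivConst (volume : Measure (Eucl n)) ((n : ℝ) / (n - 1))

theorem sobolevConst_ne_top (n : ℕ) : sobolevConst n ≠ ⊤ := ENNReal.coe_ne_top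

/-- The Sobolev inequality for the superlevel sets of a weakly differentiable function. -/
theorem volume_superlevel_le {n : ℕ} (hn : 2 ≤ n) {Ω : Set (Eucl n)} {u : Eucl n → ℝ}
    {Du : Eucl n → Eucl n} (h : HasWeakGradient Ω u Du) (hum : Measurable u) {x₀ : Eucl n}
    {ρ₁ ρ ρ' : ℝ} (hρ₁ : 0 < ρ₁) (hρ₁ρ : ρ₁ < ρ) (hρ : ρ < ρ')
    (hΩ : Metric.closedBall x₀ ρ' ⊆ Ω) {k l : ℝ} (hkl : k < l) :
    volume (Metric.ball x₀ ρ₁ ∩ {x | l ≤ u x}) ≤ sobolevConst n *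
      (ENNReal.ofReal (transitionBound / (l - k)) *
          (∫⁻ x in Metric.ball x₀ ρ ∩ {x | k < u x ∧ u x < l}, ‖Du x‖ₑ) +
        ENNReal.ofReal (2 / (ρ - ρ₁)) * volume (Metric.ball x₀ ρ ∩ {x | k < u x}))
        ^ ((n : ℝ) / (n - 1)) := by
  obtain ⟨w, b, c, hw, hw0, hw1, hae, hb, hbc, hc⟩ := exists_truncated_approx h hρ hΩ hkl
  have hρ0 : 0 < ρ := hρ₁.trans hρ₁ρ
  have hn1 : (1 : ℝ) < n := by exact_mod_cast (show 1 < n by omega)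
  set p : ℝ := (n : ℝ) / (n - 1) with hp
  have hpp : 0 < p := div_pos (by linarith) (by linarith)
  have hconj : Real.HolderConjugate (Module.finrank ℝ (Eucl n)) p := by
    rw [finrank_euclideanSpace, Fintype.card_fin]
    exact Real.HolderConjugate.conjExponent hn1
  -- With this σ the plateau has radius ρ(1 - σ) = ρ₁ and the slope is at most 2/(ρ - ρ₁).
  obtain ⟨ζ, hζ⟩ := exists_isCutoff x₀ (κ := 2) (r := ρ) (σ := (ρ - ρ₁) / ρ) one_lt_two hρ0
    (div_pos (by linarith) hρ0) ((div_lt_one hρ0).2 (by linarith))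
  have hζ1 : ∀ x ∈ Metric.ball x₀ ρ₁, ζ x = 1 := by
    have : ρ * (1 - (ρ - ρ₁) / ρ) = ρ₁ := by field_simp; ring
    have h2 := hζ.eq_one
    rwa [this] at h2
  have hζd : ∀ x, ‖fderiv ℝ ζ x‖ₑ ≤ ENNReal.ofReal (2 / (ρ - ρ₁)) := fun x => by
    rw [← ofReal_norm]
    refine ENNReal.ofReal_le_ofReal ((hζ.norm_fderiv_le x).trans (le_of_eq ?_))
    rw [div_mul_cancel₀ _ hρ0.ne', div_eq_mul_inv]
  set B := Metric.ball x₀ ρ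
  set B₁ := Metric.ball x₀ ρ₁
  have hBm : MeasurableSet B := measurableSet_ball
  have hB₁m : MeasurableSet B₁ := measurableSet_ball
  have hB₁B : B₁ ⊆ B := Metric.ball_subset_ball hρ₁ρ.le
  set θ : Eucl n → ℝ := fun x => levelStep k l (u x)
  have hS : MeasurableSet {x | l ≤ u x} := measurableSet_le measurable_const hum
  have hT : MeasurableSet {x | k < u x} := measurableSet_lt measurable_const hum
  set K := ENNReal.ofReal (2 / (ρ - ρ₁))
  -- The product rule for ζ wᵢ gives these two terms: the gradient of the truncation and the
  -- truncation times the slope of the cutoff.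
  set G : ℕ → ℝ≥0∞ := fun i => b i + K * ∫⁻ x in B, ‖w i x‖ₑ with hG
  have hGlim : Tendsto G atTop (𝓝 (c + K * ∫⁻ x in B, ‖θ x‖ₑ)) := by
    refine hbc.add (ENNReal.Tendsto.const_mul ?_ (Or.inr ENNReal.ofReal_ne_top))
    refine tendsto_lintegral_of_dominated_convergence' (fun _ => 1)
      (fun i => (hw i).continuous.enorm.aemeasurable) (fun i => Eventually.of_forall fun x => ?_)
      ?_ ?_
    · dsimp only
      rw [Real.enorm_of_nonneg (hw0 i x), ← ENNReal.ofReal_one]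
      exact ENNReal.ofReal_le_ofReal (hw1 i x)
    · simpa using measure_ball_lt_top.ne
    · filter_upwards [hae] with x hx
      exact hx.enorm
  have hgns : ∀ i, ∫⁻ x in B₁, ‖w i x‖ₑ ^ p ≤ sobolevConst n * G i ^ p := by
    intro i
    have hzw : ContDiff ℝ 1 (fun x => ζ x * w i x) :=
      (hζ.contDiff.mul (hw i)).of_le (by simp)
    have hzs : HasCompactSupport (fun x => ζ x * w i x) := hζ.hasCompactSupport.mul_right
    have h1 := lintegral_pow_le_pow_lintegral_fderiv (volume : Measure (Eucl n)) hzw hzs hconj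
    have h2 : ∫⁻ x, ‖fderiv ℝ (fun x => ζ x * w i x) x‖ₑ ≤ G i := by
      have h3 : ∀ x, x ∉ B → fderiv ℝ (fun x => ζ x * w i x) x = 0 := fun x hx => by
        by_contra hne
        refine hx (hζ.tsupport_subset ?_)
        exact closure_mono (Function.support_mul_subset_left ζ (w i)) (support_fderiv_subset ℝ hne)
      have h4 : ∫⁻ x, ‖fderiv ℝ (fun x => ζ x * w i x) x‖ₑ
          = ∫⁻ x in B, ‖fderiv ℝ (fun x => ζ x * w i x) x‖ₑ := by
        rw [← lintegral_indicator hBm]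
        refine lintegral_congr fun x => ?_
        by_cases hx : x ∈ B
        · rw [indicator_of_mem hx]
        · rw [indicator_of_notMem hx, h3 x hx, ← ofReal_norm, norm_zero, ENNReal.ofReal_zero]
      rw [h4]
      calc _ ≤ ∫⁻ x in B, (‖fderiv ℝ (w i) x‖ₑ + K * ‖w i x‖ₑ) := by
            refine lintegral_mono fun x => ?_
            dsimp only
            have hd1 : DifferentiableAt ℝ ζ x :=
              (hζ.contDiff.differentiable (by simp)).differentiableAt
            have hd2 : DifferentiableAt ℝ (w i) x :=
              ((hw i).differentiable (by simp)).differentiableAt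
            rw [fderiv_fun_mul hd1 hd2]
            refine (enorm_add_le (ζ x • fderiv ℝ (w i) x) (w i x • fderiv ℝ ζ x)).trans ?_
            rw [enorm_smul, enorm_smul, mul_comm K]
            gcongr
            · refine mul_le_of_le_one_left zero_le ?_
              rw [Real.enorm_of_nonneg (hζ.nonneg x), ← ENNReal.ofReal_one]
              exact ENNReal.ofReal_le_ofReal (hζ.le_one x)
            · exact hζd x
        _ = (∫⁻ x in B, ‖fderiv ℝ (w i) x‖ₑ) + K * ∫⁻ x in B, ‖w i x‖ₑ := by
            rw [lintegral_add_left ((hw i).continuous_fderiv (by simp)).enorm.measurable,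
              lintegral_const_mul' _ _ ENNReal.ofReal_ne_top]
        _ ≤ G i := by
            simp only [hG]
            gcongr
            exact hb i
    calc ∫⁻ x in B₁, ‖w i x‖ₑ ^ p = ∫⁻ x in B₁, ‖ζ x * w i x‖ₑ ^ p :=
          setLIntegral_congr_fun hB₁m fun x hx => by simp only [hζ1 x hx, one_mul]
      _ ≤ ∫⁻ x, ‖ζ x * w i x‖ₑ ^ p := setLIntegral_le_lintegral _ _
      _ ≤ _ := h1
      _ ≤ sobolevConst n * G i ^ p := by
          unfold sobolevConst
          gcongr
  calc volume (B₁ ∩ {x | l ≤ u x}) = ∫⁻ _ in B₁ ∩ {x | l ≤ u x}, 1 := by simp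
    _ ≤ ∫⁻ x in B₁ ∩ {x | l ≤ u x}, ‖θ x‖ₑ ^ p := by
        refine setLIntegral_mono' (hB₁m.inter hS) fun x hx => ?_
        simp only [θ]
        rw [levelStep_eq_one hkl hx.2]
        simp
    _ ≤ ∫⁻ x in B₁, ‖θ x‖ₑ ^ p := lintegral_mono_set inter_subset_left
    _ ≤ ∫⁻ x in B₁, liminf (fun i => ‖w i x‖ₑ ^ p) atTop := by
        refine lintegral_mono_ae ?_
        filter_upwards [ae_restrict_of_ae_restrict_of_subset hB₁B hae] with x hx
        exact ((ENNReal.continuous_rpow_const.tendsto _).comp hx.enorm).liminf_eq.ge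
    _ ≤ liminf (fun i => ∫⁻ x in B₁, ‖w i x‖ₑ ^ p) atTop :=
        lintegral_liminf_le fun i =>
          ENNReal.continuous_rpow_const.measurable.comp (hw i).continuous.enorm.measurable
    _ ≤ liminf (fun i => sobolevConst n * G i ^ p) atTop :=
        liminf_le_liminf (Eventually.of_forall hgns)
    _ = sobolevConst n * (c + K * ∫⁻ x in B, ‖θ x‖ₑ) ^ p :=
        (ENNReal.Tendsto.const_mul ((ENNReal.continuous_rpow_const.tendsto _).comp hGlim)
          (Or.inr (sobolevConst_ne_top n))).liminf_eq
    _ ≤ _ := by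
        gcongr
        rw [inter_comm, ← Measure.restrict_apply' hBm, ← lintegral_indicator_one hT]
        refine lintegral_mono fun x => ?_
        by_cases hx : k < u x
        · rw [indicator_of_mem (show x ∈ {x | k < u x} from hx)]
          rw [Real.enorm_of_nonneg (levelStep_nonneg _), Pi.one_apply, ← ENNReal.ofReal_one]
          exact ENNReal.ofReal_le_ofReal (levelStep_le_one _)
        · simp only [θ]
          rw [levelStep_eq_zero hkl (not_lt.1 hx)]
          simp

/-! ### Recursive inequalities with a superlinear power -/

/-- Fast geometric convergence. -/
theorem exists_fast_geometric_convergence {α b A : ℝ} (hα : 0 < α) (hb : 1 < b) (hA : 0 ≤ A) :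
    ∃ θ : ℝ, 0 < θ ∧ ∀ Y : ℕ → ℝ, (∀ j, 0 ≤ Y j) →
      (∀ j, Y (j + 1) ≤ A * b ^ j * Y j ^ (1 + α)) → Y 0 ≤ θ → Tendsto Y atTop (𝓝 0) := by
  have hb0 : 0 < b := by linarith
  -- The bound Y j ≤ θ τ^j is propagated. The choice b τ^α = 1 cancels the growing factor b^j, and A
  -- θ^α = τ A/(A + 1) ≤ τ supplies the next factor τ; A + 1 in place of A also admits A = 0.
  set τ : ℝ := b ^ (-(1 / α)) with hτ
  have hτ0 : 0 < τ := Real.rpow_pos_of_pos hb0 _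
  have hτ1 : τ < 1 := Real.rpow_lt_one_of_one_lt_of_neg hb (neg_lt_zero.2 (by positivity))
  have hbτ : b * τ ^ α = 1 := by
    rw [hτ, ← Real.rpow_mul hb0.le, neg_mul, one_div_mul_cancel hα.ne', Real.rpow_neg_one,
      mul_inv_cancel₀ hb0.ne']
  set θ : ℝ := (τ / (A + 1)) ^ (1 / α) with hθ
  have hq : 0 < τ / (A + 1) := by positivity
  have hθ0 : 0 < θ := Real.rpow_pos_of_pos hq _
  have hθα : θ ^ α = τ / (A + 1) := by
    rw [hθ, ← Real.rpow_mul hq.le, one_div_mul_cancel hα.ne', Real.rpow_one]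
  refine ⟨θ, hθ0, fun Y hY0 hrec h0 => ?_⟩
  have key : ∀ j, Y j ≤ θ * τ ^ j := by
    intro j
    induction j with
    | zero => simpa using h0
    | succ j ih =>
      have hpos : 0 < θ * τ ^ j := by positivity
      calc Y (j + 1) ≤ A * b ^ j * Y j ^ (1 + α) := hrec j
        _ ≤ A * b ^ j * (θ * τ ^ j) ^ (1 + α) := by
            gcongr
            exact hY0 j
        _ = A * θ ^ α * (b * τ ^ α) ^ j * (θ * τ ^ j) := by
            have h2 : (τ ^ j) ^ α = (τ ^ α) ^ j := by
              rw [← Real.rpow_natCast, ← Real.rpow_natCast, ← Real.rpow_mul hτ0.le,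
                ← Real.rpow_mul hτ0.le, mul_comm]
            rw [Real.rpow_add hpos, Real.rpow_one, Real.mul_rpow hθ0.le (by positivity), mul_pow, h2]
            ring
        _ = A / (A + 1) * (θ * τ ^ (j + 1)) := by
            rw [hbτ, hθα, one_pow]
            ring
        _ ≤ 1 * (θ * τ ^ (j + 1)) := by
            gcongr
            rw [div_le_one (by positivity)]
            linarith
        _ = θ * τ ^ (j + 1) := one_mul _
  refine squeeze_zero hY0 key ?_
  simpa using (tendsto_pow_atTop_nhds_zero_of_lt_one hτ0.le hτ1).const_mul θ

/-! ### Level-set inequalities in real form -/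

section level
variable {n : ℕ} {Ω : Set (Eucl n)} {u : Eucl n → ℝ} {Du : Eucl n → Eucl n} {x₀ : Eucl n}

theorem volume_ball_inter_ne_top (ρ : ℝ) (S : Set (Eucl n)) :
    volume (Metric.ball x₀ ρ ∩ S) ≠ ⊤ :=
  ((measure_mono inter_subset_left).trans_lt measure_ball_lt_top).ne

/-- De Giorgi's isoperimetric inequality for the upper part of a function that is below the
level `k` on at least half of a ball. -/
theorem volume_real_superlevel_le_of_half (h : HasWeakGradient Ω u Du) (hum : Measurable u)
    {ρ ρ' : ℝ} (hρ0 : 0 < ρ) (hρ : ρ < ρ') (hΩ : Metric.closedBall x₀ ρ' ⊆ Ω) {k l I : ℝ}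
    (hkl : k < l) (hI0 : 0 ≤ I)
    (hI : ∫⁻ x in Metric.ball x₀ ρ ∩ {x | k < u x ∧ u x ≤ l}, ‖Du x‖ₑ ≤ ENNReal.ofReal I)
    (hhalf : 1 / 2 * volume.real (Metric.ball x₀ ρ)
      ≤ volume.real (Metric.ball x₀ ρ ∩ {x | u x ≤ k})) :
    volume.real (Metric.ball x₀ ρ ∩ {x | l < u x})
      ≤ 4 * ρ * 2 ^ n * (transitionBound / (l - k)) * I := by
  have hT := transitionBound_pos
  have hlk := sub_pos.2 hkl
  have h1 := volume_superlevel_mul_volume_sublevel_le h hum hρ hΩ hkl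
  have h2 : volume (Metric.ball x₀ ρ ∩ {x | l < u x}) * volume (Metric.ball x₀ ρ ∩ {x | u x ≤ k}) ≤
      ENNReal.ofReal (2 * ρ) * 2 ^ n * volume (Metric.ball x₀ ρ) *
        (ENNReal.ofReal (transitionBound / (l - k)) * ENNReal.ofReal I) := by
    refine le_trans ?_ (h1.trans ?_)
    · gcongr
      exact fun hx => hx.le
    · gcongr
      refine le_trans (lintegral_mono_set ?_) hI
      gcongr
      exact fun hx => hx.le
  have h3 := ENNReal.toReal_mono (by finiteness) h2
  simp only [ENNReal.toReal_mul, ENNReal.toReal_pow, ENNReal.toReal_ofNat] at h3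
  rw [ENNReal.toReal_ofReal (by positivity), ENNReal.toReal_ofReal (by positivity),
    ENNReal.toReal_ofReal hI0] at h3
  simp only [← measureReal_def] at h3
  have hB : 0 < volume.real (Metric.ball x₀ ρ) := by
    rw [measureReal_def]
    exact ENNReal.toReal_pos (Metric.measure_ball_pos volume x₀ hρ0).ne' measure_ball_lt_top.ne
  -- The sublevel set fills half of the ball, so the volume of the ball cancels and 2ρ becomes 4ρ.
  have h4 : volume.real (Metric.ball x₀ ρ ∩ {x | l < u x}) *
      (1 / 2 * volume.real (Metric.ball x₀ ρ)) ≤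
      2 * ρ * 2 ^ n * volume.real (Metric.ball x₀ ρ) * (transitionBound / (l - k) * I) :=
    le_trans (by gcongr) h3
  have h5 : volume.real (Metric.ball x₀ ρ ∩ {x | l < u x}) * volume.real (Metric.ball x₀ ρ) ≤
      4 * ρ * 2 ^ n * (transitionBound / (l - k)) * I * volume.real (Metric.ball x₀ ρ) := by
    linarith
  exact le_of_mul_le_mul_right h5 hB

/-- The Sobolev inequality for superlevel sets, in terms of real numbers. -/
theorem volume_real_superlevel_le (hn : 2 ≤ n) (h : HasWeakGradient Ω u Du) (hum : Measurable u)
    {ρ₁ ρ ρ' : ℝ} (hρ₁ : 0 < ρ₁) (hρ₁ρ : ρ₁ < ρ) (hρ : ρ < ρ')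
    (hΩ : Metric.closedBall x₀ ρ' ⊆ Ω) {k l I : ℝ} (hkl : k < l) (hI0 : 0 ≤ I)
    (hI : ∫⁻ x in Metric.ball x₀ ρ ∩ {x | k < u x ∧ u x ≤ l}, ‖Du x‖ₑ ≤ ENNReal.ofReal I) :
    volume.real (Metric.ball x₀ ρ₁ ∩ {x | l < u x}) ≤ (sobolevConst n).toReal *
      (transitionBound / (l - k) * I +
        2 / (ρ - ρ₁) * volume.real (Metric.ball x₀ ρ ∩ {x | k < u x})) ^ ((n : ℝ) / (n - 1)) := by
  have hT := transitionBound_pos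
  have hlk := sub_pos.2 hkl
  have hρρ := sub_pos.2 hρ₁ρ
  have hn1 : (1 : ℝ) < n := by exact_mod_cast (show 1 < n by omega)
  have hp : 0 ≤ (n : ℝ) / (n - 1) := div_nonneg (by linarith) (by linarith)
  have h1 := volume_superlevel_le hn h hum hρ₁ hρ₁ρ hρ hΩ hkl
  have h2 : volume (Metric.ball x₀ ρ₁ ∩ {x | l < u x}) ≤ sobolevConst n *
      (ENNReal.ofReal (transitionBound / (l - k)) * ENNReal.ofReal I +
        ENNReal.ofReal (2 / (ρ - ρ₁)) * volume (Metric.ball x₀ ρ ∩ {x | k < u x}))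
        ^ ((n : ℝ) / (n - 1)) := by
    refine le_trans ?_ (h1.trans ?_)
    · gcongr
      exact fun hx => hx.le
    · gcongr
      refine le_trans (lintegral_mono_set ?_) hI
      gcongr
      exact fun hx => hx.le
  have hV := volume_ball_inter_ne_top (x₀ := x₀) ρ {x | k < u x}
  have hS := sobolevConst_ne_top n
  have h3 := ENNReal.toReal_mono (ENNReal.mul_ne_top hS
    (ENNReal.rpow_ne_top_of_nonneg hp (by finiteness))) h2
  rw [ENNReal.toReal_mul, ← ENNReal.toReal_rpow, ENNReal.toReal_add (by finiteness) (by finiteness),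
    ENNReal.toReal_mul, ENNReal.toReal_mul, ENNReal.toReal_ofReal (by positivity),
    ENNReal.toReal_ofReal hI0, ENNReal.toReal_ofReal (by positivity)] at h3
  exact h3

end level

/-! ### Reduction of the supremum from the gradient estimate -/

/-- The gradient estimate on level sets in balls about `x₀` that the energy inequalities give for
the levels at distance at most `M * lam r` from the supremum. -/
def LevelGradientBound {n : ℕ} (u : Eucl n → ℝ) (Du : Eucl n → Eucl n) (x₀ : Eucl n) (R : ℝ)
    (lam : ℝ → ℝ) (M C p q : ℝ) : Prop :=
  ∀ r : ℝ, 0 < r → r < R / 16 → ∀ ρ : ℝ, r / 2 ≤ ρ → ρ ≤ r → ∀ k l D ε σ : ℝ, k < l → |k| < M →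
    |l| < M → 0 < ε → ε ≤ 1 → 0 < σ → σ < 1 → D ≤ M * lam r →
    (∀ᵐ x ∂volume.restrict (Metric.ball x₀ ρ), u x ≤ k + D) →
    (¬ ∀ᵐ x ∂volume.restrict (Metric.ball x₀ ρ), u x ≤ k + ρ) →
    ∫⁻ x in Metric.ball x₀ (ρ * (1 - σ)) ∩ {x | k < u x ∧ u x ≤ l}, ‖Du x‖ₑ ≤
      ENNReal.ofReal (C * (D / (ε * ρ) *
          volume.real (Metric.ball x₀ ρ ∩ {x | k < u x ∧ u x ≤ l}) +
        σ ^ (-q) * ε ^ (p - 1) * (D / ρ) * volume.real (Metric.ball x₀ ρ ∩ {x | k < u x})))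

section reduction
variable {n : ℕ} {Ω : Set (Eucl n)} {u : Eucl n → ℝ} {Du : Eucl n → Eucl n} {x₀ : Eucl n}
  {R M C p q : ℝ} {lam : ℝ → ℝ}

/-- The superlevel sets shrink when the level is raised half way to the supremum. -/
theorem volume_real_level_shrink (h : HasWeakGradient Ω u Du) (hum : Measurable u)
    (hΩ : Metric.ball x₀ R ⊆ Ω) (hC : 0 < C) (hq : 0 < q)
    (hGB : LevelGradientBound u Du x₀ R lam M C p q) {r : ℝ} (hr : 0 < r) (hrR : r < R / 16)
    {k D ε : ℝ} (hk : |k| < M) (hl : |k + D / 2| < M) (hε : 0 < ε) (hε1 : ε ≤ 1) (hD : 0 < D)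
    (hDM : D ≤ M * lam r) (hup : ∀ᵐ x ∂volume.restrict (Metric.ball x₀ r), u x ≤ k + D)
    (hlow : ¬ ∀ᵐ x ∂volume.restrict (Metric.ball x₀ r), u x ≤ k + r)
    (hhalf : 1 / 2 * volume.real (Metric.ball x₀ (3 / 4 * r))
      ≤ volume.real (Metric.ball x₀ (3 / 4 * r) ∩ {x | u x ≤ k})) :
    volume.real (Metric.ball x₀ (3 / 4 * r) ∩ {x | k + D / 2 < u x}) ≤
      8 * 2 ^ n * transitionBound * C * 4 ^ q *
        (ε⁻¹ * (volume.real (Metric.ball x₀ r ∩ {x | k < u x}) -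
            volume.real (Metric.ball x₀ r ∩ {x | k + D / 2 < u x})) +
          ε ^ (p - 1) * volume.real (Metric.ball x₀ r)) := by
  have hT := transitionBound_pos
  -- The choice σ = 1/4 makes 3r/4 the inner radius, that of the ball in the half-measure
  -- hypothesis.
  have hg := hGB r hr hrR r (by linarith) le_rfl k (k + D / 2) D ε (1 / 4) (by linarith) hk hl hε
    hε1 (by norm_num) (by norm_num) hDM hup hlow
  rw [show r * (1 - 1 / 4) = 3 / 4 * r by ring] at hg
  set B := Metric.ball x₀ r
  set a := volume.real (B ∩ {x | k < u x ∧ u x ≤ k + D / 2}) with ha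
  set I := C * (D / (ε * r) * a + (1 / 4) ^ (-q) * ε ^ (p - 1) * (D / r) *
    volume.real (B ∩ {x | k < u x})) with hI
  have hI0 : 0 ≤ I := by positivity
  have hmain := volume_real_superlevel_le_of_half h hum (ρ := 3 / 4 * r) (ρ' := r) (by linarith)
    (by linarith) ((Metric.closedBall_subset_ball (by linarith)).trans hΩ)
    (show k < k + D / 2 by linarith) hI0 hg hhalf
  -- Written as a difference of superlevel measures, the measure of the strip telescopes when the
  -- inequality is summed over levels.
  have hae : a = volume.real (B ∩ {x | k < u x}) - volume.real (B ∩ {x | k + D / 2 < u x}) := by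
    have hm : MeasurableSet (B ∩ {x | k + D / 2 < u x}) :=
      measurableSet_ball.inter (measurableSet_lt measurable_const hum)
    rw [ha, ← measureReal_sdiff (by
      gcongr
      linarith) hm (volume_ball_inter_ne_top _ _)]
    congr 1
    ext x
    simp only [B, mem_inter_iff, mem_ofPred_eq, Set.mem_sdiff, not_and, not_lt]
    tauto
  have hV : volume.real (B ∩ {x | k < u x}) ≤ volume.real B :=
    measureReal_mono inter_subset_left measure_ball_lt_top.ne
  have h4 : ((1 : ℝ) / 4) ^ (-q) = 4 ^ q := by
    rw [one_div, Real.inv_rpow (by norm_num), Real.rpow_neg (by norm_num), inv_inv]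
  have h41 : (1 : ℝ) ≤ 4 ^ q := Real.one_le_rpow (by norm_num) hq.le
  have ha0 : 0 ≤ a := measureReal_nonneg
  rw [← hae]
  refine hmain.trans ?_
  rw [hI, h4, show k + D / 2 - k = D / 2 by ring]
  calc 4 * (3 / 4 * r) * 2 ^ n * (transitionBound / (D / 2)) *
        (C * (D / (ε * r) * a + 4 ^ q * ε ^ (p - 1) * (D / r) * volume.real (B ∩ {x | k < u x})))
      = 6 * 2 ^ n * transitionBound * C *
        (1 * (ε⁻¹ * a) + 4 ^ q * (ε ^ (p - 1) * volume.real (B ∩ {x | k < u x}))) := by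
        field_simp
        ring
    _ ≤ 8 * 2 ^ n * transitionBound * C *
        (4 ^ q * (ε⁻¹ * a) + 4 ^ q * (ε ^ (p - 1) * volume.real B)) := by
        gcongr
        norm_num
    _ = _ := by ring

/-- One step of De Giorgi's iteration. -/
theorem volume_real_level_step (hn : 2 ≤ n) (h : HasWeakGradient Ω u Du) (hum : Measurable u)
    (hΩ : Metric.ball x₀ R ⊆ Ω) (hC : 0 < C) (hq : 0 < q)
    (hGB : LevelGradientBound u Du x₀ R lam M C p q) {r : ℝ} (hr : 0 < r) (hrR : r < R / 16)
    {ρ k D d : ℝ} (hd : 0 < d) (hd1 : d ≤ 1) (hρ : r / 2 + r / 4 * d ≤ ρ) (hρr : ρ ≤ r)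
    (hk : |k| < M) (hl : |k + D * d / 4| < M) (hD : 0 < D)
    (hDM : D ≤ M * lam r) (hup : ∀ᵐ x ∂volume.restrict (Metric.ball x₀ ρ), u x ≤ k + D)
    (hlow : ¬ ∀ᵐ x ∂volume.restrict (Metric.ball x₀ ρ), u x ≤ k + ρ) :
    volume.real (Metric.ball x₀ (ρ - r / 8 * d) ∩ {x | k + D * d / 4 < u x}) ≤
      (sobolevConst n).toReal * ((8 * transitionBound * C * (1 + 16 ^ q) + 32) / r *
        d⁻¹ ^ (1 + q) * volume.real (Metric.ball x₀ ρ ∩ {x | k < u x})) ^ ((n : ℝ) / (n - 1)) := by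
  have hT := transitionBound_pos
  have hrd : 0 < r * d := by positivity
  have hρ0 : 0 < ρ := by linarith
  have hDd : 0 < D * d := by positivity
  -- The radius shrinks by rd/8 in all: the energy inequality uses the first rd/16, since ρ(1 - σ) =
  -- ρ - rd/16, and the Sobolev cutoff uses the second.
  set σ : ℝ := r / 16 * d / ρ with hσ
  have hσ0 : 0 < σ := by positivity
  have hσ1 : σ < 1 := by
    rw [hσ, div_lt_one hρ0]
    linarith
  have hσd : d / 16 ≤ σ := by
    rw [hσ, le_div_iff₀ hρ0]
    nlinarith
  have hg := hGB r hr hrR ρ (by linarith) hρr k (k + D * d / 4) D 1 σ (by linarith) hk hl one_pos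
    le_rfl hσ0 hσ1 hDM hup hlow
  have hρσ : ρ * (1 - σ) = ρ - r / 16 * d := by
    rw [hσ]
    field_simp
  rw [hρσ, one_mul, Real.one_rpow, mul_one] at hg
  set V := volume.real (Metric.ball x₀ ρ ∩ {x | k < u x}) with hV
  set a := volume.real (Metric.ball x₀ ρ ∩ {x | k < u x ∧ u x ≤ k + D * d / 4}) with ha
  have haV : a ≤ V := by
    refine measureReal_mono ?_ (volume_ball_inter_ne_top _ _)
    gcongr
    exact fun hx => hx.1
  have hV0 : 0 ≤ V := measureReal_nonneg
  have hI0 : 0 ≤ C * (D / ρ * a + σ ^ (-q) * (D / ρ) * V) := by positivity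
  have hmain := volume_real_superlevel_le hn h hum (ρ₁ := ρ - r / 8 * d) (ρ := ρ - r / 16 * d)
    (ρ' := r) (by linarith) (by linarith) (by linarith)
    ((Metric.closedBall_subset_ball (by linarith)).trans hΩ)
    (show k < k + D * d / 4 by linarith) hI0 hg
  refine hmain.trans ?_
  have hn1 : (1 : ℝ) < n := by exact_mod_cast (show 1 < n by omega)
  have hp : 0 ≤ (n : ℝ) / (n - 1) := div_nonneg (by linarith) (by linarith)
  have hd' : (1 : ℝ) ≤ d⁻¹ := (one_le_inv₀ hd).2 hd1
  have hdq : 1 ≤ d⁻¹ ^ q := Real.one_le_rpow hd' hq.le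
  have hσq : σ ^ (-q) ≤ 16 ^ q * d⁻¹ ^ q := by
    rw [← Real.mul_rpow (by norm_num) (by positivity), Real.rpow_neg hσ0.le,
      ← Real.inv_rpow hσ0.le]
    refine Real.rpow_le_rpow (by positivity) ?_ hq.le
    rw [inv_le_comm₀ hσ0 (by positivity), mul_inv, inv_inv]
    linarith
  have hV' : volume.real (Metric.ball x₀ (ρ - r / 16 * d) ∩ {x | k < u x}) ≤ V := by
    refine measureReal_mono ?_ (volume_ball_inter_ne_top _ _)
    gcongr
    linarith
  have hρinv : 1 / ρ ≤ 2 / r := by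
    rw [div_le_div_iff₀ hρ0 hr]
    linarith
  rw [show k + D * d / 4 - k = D * d / 4 by ring,
    show ρ - r / 16 * d - (ρ - r / 8 * d) = r * d / 16 by ring]
  refine mul_le_mul_of_nonneg_left (Real.rpow_le_rpow (by positivity) ?_ hp) ENNReal.toReal_nonneg
  -- The level gap Dd/4 and the radius gap rd/16 each give one factor d⁻¹, and σ^(-q) gives d^(-q);
  -- D itself cancels.
  calc transitionBound / (D * d / 4) * (C * (D / ρ * a + σ ^ (-q) * (D / ρ) * V)) +
        2 / (r * d / 16) *
          volume.real (Metric.ball x₀ (ρ - r / 16 * d) ∩ {x | k < u x})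
      = 4 * transitionBound * C * d⁻¹ * (1 / ρ) * (a + σ ^ (-q) * V) +
        32 / r * d⁻¹ * volume.real (Metric.ball x₀ (ρ - r / 16 * d) ∩ {x | k < u x}) := by
        field_simp
        ring
    _ ≤ 4 * transitionBound * C * d⁻¹ * (2 / r) * (d⁻¹ ^ q * V + 16 ^ q * d⁻¹ ^ q * V) +
        32 / r * d⁻¹ * (d⁻¹ ^ q * V) := by
        have : V ≤ d⁻¹ ^ q * V := le_mul_of_one_le_left hV0 hdq
        gcongr
        · exact haV.trans this
        · exact hV'.trans this
    _ = _ := by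
        rw [Real.rpow_add (by positivity), Real.rpow_one]
        field_simp
        ring

end reduction

section reduction
variable {n : ℕ} {Ω : Set (Eucl n)} {u : Eucl n → ℝ} {Du : Eucl n → Eucl n} {x₀ : Eucl n}
  {R M C p q : ℝ} {lam : ℝ → ℝ}

theorem volume_real_ball (x₀ : Eucl n) {r : ℝ} (hr : 0 < r) :
    volume.real (Metric.ball x₀ r) = r ^ n * volume.real (Metric.ball (0 : Eucl n) 1) := by
  rw [measureReal_def, measureReal_def, Measure.addHaar_ball_of_pos _ _ hr, finrank_euclideanSpace,
    Fintype.card_fin, ENNReal.toReal_mul, ENNReal.toReal_ofReal (by positivity)]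

/-- De Giorgi's lemma: if `u` exceeds `μ - D` only on a small part of a ball, then it is bounded
by `μ - D / 4` on a smaller ball. -/
theorem exists_measure_criterion (hn : 2 ≤ n) (h : HasWeakGradient Ω u Du) (hum : Measurable u)
    (hΩ : Metric.ball x₀ R ⊆ Ω) (hC : 0 < C) (hq : 0 < q)
    (hGB : LevelGradientBound u Du x₀ R lam M C p q) :
    ∃ θ : ℝ, 0 < θ ∧ ∀ r : ℝ, 0 < r → r < R / 16 → ∀ μ D : ℝ, μ ≤ M → -M < μ - D → 0 < D →
      D ≤ M * lam r → r ≤ D / 4 → (∀ᵐ x ∂volume.restrict (Metric.ball x₀ r), u x ≤ μ) →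
      volume.real (Metric.ball x₀ (3 / 4 * r) ∩ {x | μ - D < u x}) ≤ θ * r ^ n →
      ∀ᵐ x ∂volume.restrict (Metric.ball x₀ (r / 2)), u x ≤ μ - D / 4 := by
  have hn1 : (1 : ℝ) < n := by exact_mod_cast (show 1 < n by omega)
  have hn0 : (0 : ℝ) < n - 1 := by linarith
  have hT := transitionBound_pos
  set P : ℝ := (n : ℝ) / (n - 1) with hP
  have hP0 : 0 < P := by positivity
  have hPα : 1 + 1 / ((n : ℝ) - 1) = P := by
    rw [hP]
    field_simp
    ring
  set C₂ : ℝ := 8 * transitionBound * C * (1 + 16 ^ q) + 32 with hC₂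
  have hC₂0 : 0 < C₂ := by positivity
  set S : ℝ := (sobolevConst n).toReal with hS
  have hS0 : 0 ≤ S := ENNReal.toReal_nonneg
  set b : ℝ := (2 ^ (1 + q)) ^ P with hb
  have hb1 : 1 < b :=
    Real.one_lt_rpow (Real.one_lt_rpow one_lt_two (by linarith)) hP0
  -- The Sobolev exponent n/(n - 1) is 1 + α with α = 1/(n - 1); b is the growth per step of the
  -- factor (d j)^(-(1+q)), raised to that exponent.
  obtain ⟨θ, hθ, hconv⟩ := exists_fast_geometric_convergence (α := 1 / ((n : ℝ) - 1)) (b := b)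
    (A := S * C₂ ^ P) (by positivity) hb1 (by positivity)
  refine ⟨θ, hθ, fun r hr hrR μ D hμ hμD hD hDM hrD hup hsmall => ?_⟩
  -- Failure of the conclusion supplies the lower bound on the supremum that the gradient estimate
  -- needs: for k ≤ μ - D/2 and ρ ≤ r ≤ D/4, the bound u ≤ k + ρ would give u ≤ μ - D/4.
  by_contra hnot
  have hrn : 0 < r ^ n := pow_pos hr n
  have hnlow : ∀ ρ k, r / 2 ≤ ρ → ρ ≤ r → k ≤ μ - D / 2 →
      ¬ ∀ᵐ x ∂volume.restrict (Metric.ball x₀ ρ), u x ≤ k + ρ := by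
    intro ρ k h1 h2 h3 h4
    refine hnot ?_
    filter_upwards [ae_restrict_of_ae_restrict_of_subset (Metric.ball_subset_ball h1) h4] with x hx
    linarith
  -- The radii r/2 + (r/4)d j decrease from 3r/4 to r/2, while the levels μ - D/2 - (D/2)d j rise
  -- from μ - D to μ - D/2. One D serves all levels, since each is within D of μ.
  set d : ℕ → ℝ := fun j => (1 / 2) ^ j with hd
  have hd0 : ∀ j, 0 < d j := fun j => by positivity
  have hd1 : ∀ j, d j ≤ 1 := fun j => pow_le_one₀ (by norm_num) (by norm_num)
  have hds : ∀ j, d (j + 1) = d j / 2 := fun j => by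
    simp only [hd, pow_succ]
    ring
  set V : ℕ → ℝ := fun j => volume.real
    (Metric.ball x₀ (r / 2 + r / 4 * d j) ∩ {x | μ - D / 2 - D / 2 * d j < u x}) with hV
  have hV0 : ∀ j, 0 ≤ V j := fun j => measureReal_nonneg
  have hstep : ∀ j, V (j + 1) ≤ S * (C₂ / r * (d j)⁻¹ ^ (1 + q) * V j) ^ P := by
    intro j
    have hrd : r * d j ≤ r := mul_le_of_le_one_right hr.le (hd1 j)
    have hDd : D * d j ≤ D := mul_le_of_le_one_right hD.le (hd1 j)
    have hrd0 : 0 < r * d j := mul_pos hr (hd0 j)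
    have hDd0 : 0 < D * d j := mul_pos hD (hd0 j)
    have hρr : r / 2 + r / 4 * d j ≤ r := by linarith
    have := volume_real_level_step hn h hum hΩ hC hq hGB hr hrR (ρ := r / 2 + r / 4 * d j)
      (k := μ - D / 2 - D / 2 * d j) (D := D) (hd0 j) (hd1 j) le_rfl hρr
      (abs_lt.2 ⟨by linarith, by linarith⟩) (abs_lt.2 ⟨by linarith, by linarith⟩) hD hDM
      (by
        filter_upwards [ae_restrict_of_ae_restrict_of_subset (Metric.ball_subset_ball hρr) hup]
          with x hx
        linarith)
      (hnlow _ _ (by linarith) hρr (by linarith))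
    rw [show r / 2 + r / 4 * d j - r / 8 * d j = r / 2 + r / 4 * d (j + 1) by rw [hds]; ring,
      show μ - D / 2 - D / 2 * d j + D * d j / 4 = μ - D / 2 - D / 2 * d (j + 1) by
        rw [hds]; ring] at this
    exact this
  have hlim := hconv (fun j => V j / r ^ n) (fun j => div_nonneg (hV0 j) hrn.le) (fun j => by
    rw [hPα, div_le_iff₀ hrn]
    refine (hstep j).trans (le_of_eq ?_)
    have h1 : (d j)⁻¹ ^ (1 + q) = (2 ^ (1 + q)) ^ j := by
      rw [hd]
      simp only [one_div, inv_pow, inv_inv]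
      rw [← Real.rpow_natCast, ← Real.rpow_natCast, ← Real.rpow_mul two_pos.le,
        ← Real.rpow_mul two_pos.le, mul_comm]
    have h2 : ((2 ^ (1 + q)) ^ j) ^ P = b ^ j := by
      have : (0 : ℝ) ≤ 2 ^ (1 + q) := by positivity
      rw [hb, ← Real.rpow_natCast, ← Real.rpow_natCast, ← Real.rpow_mul this,
        ← Real.rpow_mul this, mul_comm]
    -- By this scaling the recursion for V j / rⁿ is free of r, hence so is θ.
    have h3 : (r ^ ((n : ℝ) - 1)) ^ P = r ^ n := by
      rw [← Real.rpow_mul hr.le, hP, mul_div_cancel₀ _ hn0.ne', Real.rpow_natCast]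
    have h4 : C₂ / r * (d j)⁻¹ ^ (1 + q) * V j
        = C₂ * (2 ^ (1 + q)) ^ j * (V j / r ^ n) * r ^ ((n : ℝ) - 1) := by
      rw [h1, Real.rpow_sub_one hr.ne', Real.rpow_natCast]
      field_simp
    have h5 : 0 ≤ V j / r ^ n := div_nonneg (hV0 j) hrn.le
    rw [h4, Real.mul_rpow (by positivity) (by positivity), h3,
      Real.mul_rpow (by positivity) h5, Real.mul_rpow hC₂0.le (by positivity), h2]
    ring) (by
      rw [div_le_iff₀ hrn]
      refine le_trans (le_of_eq ?_) hsmall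
      simp only [hV, hd, pow_zero]
      rw [show r / 2 + r / 4 * 1 = 3 / 4 * r by ring, show μ - D / 2 - D / 2 * 1 = μ - D by ring])
  -- The limit set lies in every set of the iteration. Its vanishing gives u ≤ μ - D/2, which is
  -- stronger than the bound assumed to fail.
  have hzero : volume.real (Metric.ball x₀ (r / 2) ∩ {x | μ - D / 2 < u x}) = 0 := by
    refine le_antisymm ?_ measureReal_nonneg
    have hlim' := hlim.mul_const (r ^ n)
    rw [zero_mul] at hlim'
    refine ge_of_tendsto' hlim' fun j => ?_
    rw [div_mul_cancel₀ _ hrn.ne']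
    have h1 : 0 < r * d j := mul_pos hr (hd0 j)
    have h2 : 0 < D * d j := mul_pos hD (hd0 j)
    refine measureReal_mono (inter_subset_inter (Metric.ball_subset_ball (by linarith)) ?_)
      (volume_ball_inter_ne_top _ _)
    intro x hx
    have hx' : μ - D / 2 < u x := hx
    change μ - D / 2 - D / 2 * d j < u x
    linarith
  refine hnot ?_
  rw [measureReal_eq_zero_iff (volume_ball_inter_ne_top _ _)] at hzero
  rw [ae_restrict_iff' measurableSet_ball]
  have := measure_eq_zero_iff_ae_notMem.1 hzero
  filter_upwards [this] with x hx hxB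
  by_contra hlt
  refine hx ⟨hxB, ?_⟩
  exact lt_trans (by linarith) (not_le.1 hlt)

/-- Reduction of the supremum of `u`, provided that `u` lies below the mean of its bounds on half
of a ball. -/
theorem exists_reduction (hn : 2 ≤ n) (h : HasWeakGradient Ω u Du) (hum : Measurable u)
    (hΩ : Metric.ball x₀ R ⊆ Ω) (hC : 0 < C) (hp : 1 < p) (hq : 0 < q)
    (hlam : ∀ r ∈ Ioo 0 R, 0 < lam r ∧ lam r ≤ 1)
    (hGB : LevelGradientBound u Du x₀ R lam M C p q) :
    ∃ η : ℝ, 0 < η ∧ η < 1 ∧ ∀ r : ℝ, 0 < r → r < R / 16 → ∀ m μ : ℝ, -M ≤ m → m < μ → μ ≤ M →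
      (∀ᵐ x ∂volume.restrict (Metric.ball x₀ r), u x ≤ μ) →
      1 / 2 * volume.real (Metric.ball x₀ (3 / 4 * r))
        ≤ volume.real (Metric.ball x₀ (3 / 4 * r) ∩ {x | u x ≤ (m + μ) / 2}) →
      r ≤ η * lam r * (μ - m) →
      ∀ᵐ x ∂volume.restrict (Metric.ball x₀ (r / 2)), u x ≤ μ - η * lam r * (μ - m) := by
  obtain ⟨θ, hθ, hcrit⟩ := exists_measure_criterion hn h hum hΩ hC hq hGB
  have hT := transitionBound_pos
  set C₁ : ℝ := 8 * 2 ^ n * transitionBound * C * 4 ^ q with hC₁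
  have hC₁0 : 0 < C₁ := by positivity
  set β : ℝ := volume.real (Metric.ball (0 : Eucl n) 1) with hβ
  have hβ0 : 0 < β := ENNReal.toReal_pos
    (Metric.measure_ball_pos volume _ one_pos).ne' measure_ball_lt_top.ne
  have hp1 : 0 < p - 1 := by linarith
  -- The threshold θ is shared by two terms: ε makes the one that does not telescope at most θ/2,
  -- and then N makes the telescoped one, divided by N, at most θ/2. Neither choice depends on r.
  obtain ⟨ε, hε0, hε1, hε⟩ : ∃ ε : ℝ, 0 < ε ∧ ε ≤ 1 ∧ C₁ * ε ^ (p - 1) * β ≤ θ / 2 := by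
    have hδ : 0 < θ / (2 * C₁ * β) := by positivity
    refine ⟨min 1 ((θ / (2 * C₁ * β)) ^ (1 / (p - 1))), ?_, min_le_left _ _, ?_⟩
    · exact lt_min one_pos (Real.rpow_pos_of_pos hδ _)
    · calc C₁ * (min 1 ((θ / (2 * C₁ * β)) ^ (1 / (p - 1)))) ^ (p - 1) * β
          ≤ C₁ * ((θ / (2 * C₁ * β)) ^ (1 / (p - 1))) ^ (p - 1) * β := by
            gcongr
            exact min_le_right _ _
        _ = C₁ * (θ / (2 * C₁ * β)) * β := by
            rw [← Real.rpow_mul hδ.le, one_div_mul_cancel hp1.ne', Real.rpow_one]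
        _ ≤ θ / 2 := le_of_eq (by field_simp)
  obtain ⟨N, hN⟩ := exists_nat_gt (2 * C₁ * ε⁻¹ * β / θ)
  have hN0 : (0 : ℝ) < N := lt_of_le_of_lt (by positivity) hN
  -- The final gain is D N / 4, where D N = λ(r)(μ - m) 2⁻ᴺ / 2.
  refine ⟨(1 / 2) ^ N / 8, by positivity, ?_, ?_⟩
  · have : ((1 : ℝ) / 2) ^ N ≤ 1 := pow_le_one₀ (by norm_num) (by norm_num)
    linarith
  intro r hr hrR m μ hm hmμ hμ hup hhalf hrη
  obtain ⟨hl0, hl1⟩ := hlam r ⟨hr, by linarith⟩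
  -- Since λ ≤ 1, all levels μ - D s stay above the midpoint; since μ - m ≤ 2M, also D₀ ≤ M λ(r), as
  -- the gradient estimate requires.
  set D₀ : ℝ := lam r * (μ - m) / 2 with hD₀
  have hω : 0 < μ - m := sub_pos.2 hmμ
  have hD₀0 : 0 < D₀ := by positivity
  have hD₀ω : D₀ ≤ (μ - m) / 2 := by
    rw [hD₀]
    gcongr
    exact mul_le_of_le_one_left hω.le hl1
  have hD₀M : D₀ ≤ M * lam r := by
    rw [hD₀]
    nlinarith
  set D : ℕ → ℝ := fun s => D₀ * (1 / 2) ^ s with hD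
  have hDpos : ∀ s, 0 < D s := fun s => by positivity
  have hDanti : Antitone D := fun s t hst => by
    simp only [hD]
    gcongr ?_ * ?_
    exact pow_le_pow_of_le_one (by norm_num) (by norm_num) hst
  have hDle : ∀ s, D s ≤ D₀ := fun s => by
    simpa [hD] using hDanti (Nat.zero_le s)
  have hDs : ∀ s, D (s + 1) = D s / 2 := fun s => by
    simp only [hD, pow_succ]
    ring
  have hηD : (1 / 2) ^ N / 8 * lam r * (μ - m) = D N / 4 := by
    simp only [hD, hD₀]
    ring
  rw [hηD] at hrη ⊢
  by_contra hnot
  set B := Metric.ball x₀ r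
  set B' := Metric.ball x₀ (3 / 4 * r)
  have hlevel : ∀ s, |μ - D s| < M := fun s => by
    have h1 := hDpos s
    have h2 := hDle s
    exact abs_lt.2 ⟨by linarith, by linarith⟩
  have hshrink : ∀ s < N, volume.real (B' ∩ {x | μ - D N < u x}) ≤
      C₁ * (ε⁻¹ * (volume.real (B ∩ {x | μ - D s < u x}) -
        volume.real (B ∩ {x | μ - D (s + 1) < u x})) + ε ^ (p - 1) * volume.real B) := by
    intro s hs
    have h1 : μ - D s + D s / 2 = μ - D (s + 1) := by
      rw [hDs]
      ring
    have h2 : D N ≤ D s := hDanti hs.le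
    have h3 := volume_real_level_shrink h hum hΩ hC hq hGB hr hrR (k := μ - D s) (D := D s)
      (ε := ε) (hlevel s) (by rw [h1]; exact hlevel _) hε0 hε1 (hDpos s)
      ((hDle s).trans hD₀M) (by simpa using hup)
      (fun hcon => hnot (by
        filter_upwards [ae_restrict_of_ae_restrict_of_subset
          (Metric.ball_subset_ball (by linarith : r / 2 ≤ r)) hcon] with x hx
        have := hDpos N
        linarith))
      (hhalf.trans (measureReal_mono (inter_subset_inter_right _ (by
        intro x hx
        have hx' : u x ≤ (m + μ) / 2 := hx
        have := hDle s
        change u x ≤ μ - D s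
        linarith)) (volume_ball_inter_ne_top _ _)))
    rw [h1] at h3
    refine le_trans (measureReal_mono (inter_subset_inter_right _ ?_)
      (volume_ball_inter_ne_top _ _)) h3
    intro x hx
    have hx' : μ - D N < u x := hx
    have : D N ≤ D (s + 1) := hDanti hs
    change μ - D (s + 1) < u x
    linarith
  -- The left side of each inequality concerns the last level only, so adding them multiplies it by
  -- their number, while the differences on the right telescope.
  have hsum : ∀ s ≤ N, s * volume.real (B' ∩ {x | μ - D N < u x}) ≤
      C₁ * (ε⁻¹ * (volume.real (B ∩ {x | μ - D 0 < u x}) -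
        volume.real (B ∩ {x | μ - D s < u x})) + s * (ε ^ (p - 1) * volume.real B)) := by
    intro s
    induction s with
    | zero => simp
    | succ s ih =>
      intro hs
      have h1 := ih (by omega)
      have h2 := hshrink s (by omega)
      push_cast
      linarith
  have hBle : volume.real (B ∩ {x | μ - D 0 < u x}) ≤ volume.real B :=
    measureReal_mono inter_subset_left measure_ball_lt_top.ne
  have hB : volume.real B = r ^ n * β := volume_real_ball x₀ hr
  have hrn : 0 < r ^ n := pow_pos hr n
  have hfinal : volume.real (B' ∩ {x | μ - D N < u x}) ≤ θ * r ^ n := by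
    have h1 := hsum N le_rfl
    have h2 : N * volume.real (B' ∩ {x | μ - D N < u x}) ≤ N * (θ * r ^ n) := by
      calc N * volume.real (B' ∩ {x | μ - D N < u x})
          ≤ C₁ * (ε⁻¹ * (volume.real B - 0) + N * (ε ^ (p - 1) * volume.real B)) := by
            refine h1.trans ?_
            gcongr
            exact measureReal_nonneg
        _ = r ^ n * (C₁ * ε⁻¹ * β + N * (C₁ * ε ^ (p - 1) * β)) := by
            rw [hB]
            ring
        _ ≤ r ^ n * (N * (θ / 2) + N * (θ / 2)) := by
            rw [div_lt_iff₀ hθ] at hN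
            exact mul_le_mul_of_nonneg_left (add_le_add (by linarith)
              (mul_le_mul_of_nonneg_left hε hN0.le)) hrn.le
        _ = N * (θ * r ^ n) := by ring
    exact le_of_mul_le_mul_left h2 hN0
  have h1 := hDpos N
  have h2 := hDle N
  exact hnot (hcrit r hr hrR μ (D N) hμ (by linarith) (hDpos N) ((hDle N).trans hD₀M) hrη hup
    hfinal)

end reduction

/-! ### The De Giorgi class: symmetries and removal of the weight -/

section DeGiorgiClass
variable {n : ℕ} {Ω : Set (Eucl n)} {g : Eucl n → ℝ → ℝ} {u v : Eucl n → ℝ}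
  {Du : Eucl n → Eucl n} {M : ℝ}

theorem HasWeakGradient.congr (h : HasWeakGradient Ω u Du) (huv : u =ᵐ[volume.restrict Ω] v) :
    HasWeakGradient Ω v Du where
  locallyIntegrableOn x hx := by
    obtain ⟨s, hs, hsi⟩ := h.locallyIntegrableOn x hx
    refine ⟨s ∩ Ω, inter_mem hs self_mem_nhdsWithin, ?_⟩
    exact (hsi.mono_set inter_subset_left).congr
      (ae_restrict_of_ae_restrict_of_subset inter_subset_right huv)
  locallyIntegrableOn_grad := h.locallyIntegrableOn_grad
  integral_eq φ hφ hφc hφs e := by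
    rw [← h.integral_eq φ hφ hφc hφs e]
    refine integral_congr_ae ?_
    filter_upwards [huv] with x hx
    rw [hx]

theorem HasWeakGradient.neg (h : HasWeakGradient Ω u Du) :
    HasWeakGradient Ω (fun x => -u x) fun x => -Du x where
  locallyIntegrableOn := h.locallyIntegrableOn.neg
  locallyIntegrableOn_grad := h.locallyIntegrableOn_grad.neg
  integral_eq φ hφ hφc hφs e := by
    simp only [neg_mul, inner_neg_left, integral_neg]
    rw [h.integral_eq φ hφ hφc hφs e]

theorem EnergyPlus.congr {p q c₁ r k l ε σ : ℝ} {y : Eucl n} {ζ : Eucl n → ℝ}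
    (huv : u =ᵐ[volume.restrict (Metric.ball y r)] v)
    (h : EnergyPlus g u Du p q c₁ y r k l ε σ ζ) : EnergyPlus g v Du p q c₁ y r k l ε σ ζ := by
  have huv' := (ae_restrict_iff' measurableSet_ball).1 huv
  have hA : ∀ k, APlus u y k r =ᵐ[volume] APlus v y k r := fun k => by
    filter_upwards [huv'] with x hx
    refine propext (and_congr_right fun hxB => ?_)
    rw [hx hxB]
  have hM : MPlus u y k r = MPlus v y k r := by
    refine essSup_congr_ae ?_
    filter_upwards [huv] with x hx
    rw [hx]
  unfold EnergyPlus at h ⊢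
  rw [← hM, ← setIntegral_congr_set ((hA k).diff (hA l)), ← setIntegral_congr_set ((hA k).diff (hA l)),
    ← setIntegral_congr_set (hA k)]
  refine h.trans (le_of_eq ?_)
  congr 2
  refine integral_congr_ae ?_
  filter_upwards [ae_restrict_of_ae_restrict_of_subset (fun x hx => hx.1) huv] with x hx
  rw [hx]

theorem EnergyMinus.neg {p q c₁ r k l ε σ : ℝ} {y : Eucl n} {ζ : Eucl n → ℝ}
    (h : EnergyMinus g u Du p q c₁ y r k l ε σ ζ) :
    EnergyPlus g (fun x => -u x) (fun x => -Du x) p q c₁ y r (-l) (-k) ε σ ζ := by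
  have hs : ∀ x k, -u x - -k = -(u x - k) := fun x k => by ring
  have hA : ∀ k, APlus (fun x => -u x) y (-k) r = AMinus u y k r := fun k => by
    simp only [APlus, AMinus, hs]
  have hM : ∀ k, MPlus (fun x => -u x) y (-k) r = MMinus u y k r := fun k => by
    simp only [MPlus, MMinus, hs]
  unfold EnergyPlus
  simp only [hA, hM, hs, norm_neg]
  exact h

theorem EnergyPlus.neg {p q c₁ r k l ε σ : ℝ} {y : Eucl n} {ζ : Eucl n → ℝ}
    (h : EnergyPlus g u Du p q c₁ y r k l ε σ ζ) :
    EnergyMinus g (fun x => -u x) (fun x => -Du x) p q c₁ y r (-l) (-k) ε σ ζ := by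
  have hs : ∀ x k, -(-u x - -k) = u x - k := fun x k => by ring
  have hA : ∀ k, AMinus (fun x => -u x) y (-k) r = APlus u y k r := fun k => by
    simp only [APlus, AMinus, hs]
  have hM : ∀ k, MMinus (fun x => -u x) y (-k) r = MPlus u y k r := fun k => by
    simp only [MPlus, MMinus, hs]
  unfold EnergyMinus
  simp only [hA, hM, hs, norm_neg]
  exact h

/-- Reflection exchanges the two energy inequalities and turns the levels k < l into -l < -k. Hence
only upper level sets need to be studied. -/
theorem neg_mem_deGiorgiClass (hu : u ∈ DeGiorgiClass Ω g M) :
    (fun x => -u x) ∈ DeGiorgiClass Ω g M := by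
  obtain ⟨hM, Du, hD, p, q, c₁, κ, hp, hpq, hc, hκ, h⟩ := hu
  refine ⟨by simpa only [abs_neg] using hM, fun x => -Du x, hD.neg, p, q, c₁, κ, hp, hpq, hc, hκ,
    fun y r hr hB k l hkl hk hl ε hε hε1 σ hσ hσ1 ζ hζ => ?_⟩
  have h1 := h y r hr hB (-l) (-k) (neg_lt_neg hkl) (by rwa [abs_neg]) (by rwa [abs_neg])
    ε hε hε1 σ hσ hσ1 ζ hζ
  have h2 := h1.2.neg
  have h3 := h1.1.neg
  simp only [neg_neg] at h2 h3
  exact ⟨h2, h3⟩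

/-- This permits a Borel representative, for which all level sets are measurable. The lower energy
inequality is obtained from the upper one by reflecting twice. -/
theorem deGiorgiClass_congr (hu : u ∈ DeGiorgiClass Ω g M) (huv : u =ᵐ[volume.restrict Ω] v) :
    v ∈ DeGiorgiClass Ω g M := by
  obtain ⟨hM, Du, hD, p, q, c₁, κ, hp, hpq, hc, hκ, h⟩ := hu
  refine ⟨?_, Du, hD.congr huv, p, q, c₁, κ, hp, hpq, hc, hκ,
    fun y r hr hB k l hkl hk hl ε hε hε1 σ hσ hσ1 ζ hζ => ?_⟩
  · filter_upwards [hM, huv] with x hx hx'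
    rwa [← hx']
  have hBr : Metric.ball y r ⊆ Ω := (Metric.ball_subset_ball (by linarith)).trans hB
  have hae := ae_restrict_of_ae_restrict_of_subset hBr huv
  have hae' : (fun x => -u x) =ᵐ[volume.restrict (Metric.ball y r)] fun x => -v x := by
    filter_upwards [hae] with x hx
    rw [hx]
  have h1 := h y r hr hB k l hkl hk hl ε hε hε1 σ hσ hσ1 ζ hζ
  have h2 := (h1.2.neg.congr hae').neg
  simp only [neg_neg] at h2
  exact ⟨h1.1.congr hae, h2⟩

theorem APlus_eq (u : Eucl n → ℝ) (y : Eucl n) (k r : ℝ) :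
    APlus u y k r = Metric.ball y r ∩ {x | k < u x} := by
  ext x
  simp [APlus]

/-- A quantitative form of the energy inequality: on balls where `g` is comparable to a constant,
the weight `g` drops out. -/
theorem EnergyPlus.integral_norm_le {p q c₁ κ r k l ε σ G Λ D : ℝ} {y : Eucl n} {ζ : Eucl n → ℝ}
    (h : EnergyPlus g u Du p q c₁ y r k l ε σ ζ) (hum : Measurable u)
    (hD : IntegrableOn Du (Metric.ball y r)) (hζ : IsCutoff κ y r σ ζ) (hq : 0 < q)
    (hc₁ : 0 < c₁) (hr : 0 < r) (hε : 0 < ε) (hσ : 0 < σ) (hG : 0 < G) (hΛ : 0 < Λ)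
    (hgm : AEMeasurable (fun x => g x (MPlus u y k r / r)) (volume.restrict (Metric.ball y r)))
    (hglow : ∀ x ∈ Metric.ball y r, G ≤ Λ * g x (MPlus u y k r / r))
    (hgup : ∀ x ∈ Metric.ball y r, g x (MPlus u y k r / r) ≤ Λ * G)
    (hM0 : 0 ≤ MPlus u y k r) (hMD : MPlus u y k r ≤ D)
    (hup : ∀ᵐ x ∂volume.restrict (Metric.ball y r), u x ≤ k + D) :
    ∫ x in Metric.ball y (r * (1 - σ)) ∩ {x | k < u x ∧ u x ≤ l}, ‖Du x‖ ≤
      c₁ * Λ ^ 2 * (D / (ε * r) * volume.real (Metric.ball y r ∩ {x | k < u x ∧ u x ≤ l}) +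
        σ ^ (-q) * ε ^ (p - 1) * (D / r) * volume.real (Metric.ball y r ∩ {x | k < u x})) := by
  have hD0 : 0 ≤ D := hM0.trans hMD
  set γ : Eucl n → ℝ := fun x => g x (MPlus u y k r / r) with hγ
  set B := Metric.ball y r with hB
  have hBm : MeasurableSet B := measurableSet_ball
  have hγ0 : ∀ x ∈ B, 0 ≤ γ x := fun x hx =>
    (pos_of_mul_pos_right (hG.trans_le (hglow x hx)) hΛ.le).le
  have hT : APlus u y k r \ APlus u y l r = B ∩ {x | k < u x ∧ u x ≤ l} := by
    rw [APlus_eq, APlus_eq]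
    ext x
    simp only [B, mem_inter_iff, mem_ofPred_eq, Set.mem_sdiff, not_and, not_lt]
    tauto
  have hkm : MeasurableSet {x | k < u x} := measurableSet_lt measurable_const hum
  have hlm : MeasurableSet {x | u x ≤ l} := measurableSet_le hum measurable_const
  have hklm : MeasurableSet {x | k < u x ∧ u x ≤ l} := hkm.inter hlm
  set T := B ∩ {x | k < u x ∧ u x ≤ l} with hTdef
  have hTB : T ⊆ B := inter_subset_left
  have hTm : MeasurableSet T := hBm.inter hklm
  set S := Metric.ball y (r * (1 - σ)) ∩ {x | k < u x ∧ u x ≤ l} with hSdef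
  have hSm : MeasurableSet S := measurableSet_ball.inter hklm
  have hST : S ⊆ T := inter_subset_inter_left _ (Metric.ball_subset_ball (by nlinarith))
  unfold EnergyPlus at h
  rw [hT, APlus_eq] at h
  have hζ0 : ∀ x, 0 ≤ ζ x ^ q := fun x => Real.rpow_nonneg (hζ.nonneg x) q
  have hζ1 : ∀ x, ζ x ^ q ≤ 1 := fun x => Real.rpow_le_one (hζ.nonneg x) (hζ.le_one x) hq.le
  -- The Bochner integral of a non-integrable function is 0 by convention, so enlarging the domain
  -- from S to T needs integrability first.
  have hint : IntegrableOn (fun x => γ x * ‖Du x‖ * ζ x ^ q) T := by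
    refine Integrable.mono' ((hD.mono_set hTB).norm.const_mul (Λ * G)) ?_ ?_
    · exact (((hgm.mono_set hTB).mul (hD.mono_set hTB).1.norm.aemeasurable).mul
        (hζ.contDiff.continuous.measurable.pow_const q).aemeasurable).aestronglyMeasurable
    · refine (ae_restrict_iff' hTm).2 (Eventually.of_forall fun x hx => ?_)
      rw [Real.norm_of_nonneg (mul_nonneg (mul_nonneg (hγ0 x (hTB hx)) (norm_nonneg _)) (hζ0 x))]
      calc γ x * ‖Du x‖ * ζ x ^ q ≤ γ x * ‖Du x‖ * 1 := by
            have := hγ0 x (hTB hx)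
            gcongr
            exact hζ1 x
        _ ≤ Λ * G * ‖Du x‖ := by
            rw [mul_one]
            gcongr
            exact hgup x (hTB hx)
  -- On S the cutoff is 1 and the weight is at least G/Λ; on the right side it is at most ΛG. So G
  -- cancels and Λ² remains.
  have hleft : G / Λ * ∫ x in S, ‖Du x‖ ≤ ∫ x in T, γ x * ‖Du x‖ * ζ x ^ q := by
    rw [← integral_const_mul]
    refine le_trans ?_ (setIntegral_mono_set hint ?_ hST.eventuallyLE)
    · refine setIntegral_mono_on (((hD.mono_set (hST.trans hTB)).norm).const_mul _)
        (hint.mono_set hST) hSm fun x hx => ?_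
      rw [hζ.eq_one x hx.1, Real.one_rpow, mul_one]
      gcongr
      rw [div_le_iff₀ hΛ, mul_comm]
      exact hglow x (hTB (hST hx))
    · refine (ae_restrict_iff' hTm).2 (Eventually.of_forall fun x hx => ?_)
      exact mul_nonneg (mul_nonneg (hγ0 x (hTB hx)) (norm_nonneg _)) (hζ0 x)
  have hr1 : ∫ x in T, γ x ≤ Λ * G * volume.real T := by
    have hfin : volume T ≠ ⊤ := volume_ball_inter_ne_top _ _
    calc ∫ x in T, γ x ≤ ∫ _ in T, Λ * G := by
          refine integral_mono_of_nonneg ?_ (integrableOn_const hfin) ?_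
          · exact (ae_restrict_iff' hTm).2 (Eventually.of_forall fun x hx => hγ0 x (hTB hx))
          · exact (ae_restrict_iff' hTm).2 (Eventually.of_forall fun x hx => hgup x (hTB hx))
      _ = Λ * G * volume.real T := by
          rw [setIntegral_const, smul_eq_mul, mul_comm]
  have hr2 : ∫ x in B ∩ {x | k < u x}, γ x * (max (u x - k) 0 / r) ≤
      Λ * G * (D / r) * volume.real (B ∩ {x | k < u x}) := by
    have hfin : volume (B ∩ {x | k < u x}) ≠ ⊤ := volume_ball_inter_ne_top _ _
    have hm : MeasurableSet (B ∩ {x | k < u x}) := hBm.inter hkm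
    calc ∫ x in B ∩ {x | k < u x}, γ x * (max (u x - k) 0 / r)
        ≤ ∫ _ in B ∩ {x | k < u x}, Λ * G * (D / r) := by
          refine integral_mono_of_nonneg ?_ (integrableOn_const hfin) ?_
          · exact (ae_restrict_iff' hm).2 (Eventually.of_forall fun x hx =>
              mul_nonneg (hγ0 x hx.1) (by positivity))
          · filter_upwards [ae_restrict_of_ae_restrict_of_subset inter_subset_left hup,
              ae_restrict_mem hm] with x hx hxm
            have := hγ0 x hxm.1
            have h2 := hgup x hxm.1
            have h3 : max (u x - k) 0 ≤ D := max_le (by linarith) hD0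
            gcongr
      _ = Λ * G * (D / r) * volume.real (B ∩ {x | k < u x}) := by
          rw [setIntegral_const, smul_eq_mul, mul_comm]
  have hT0 : 0 ≤ ∫ x in T, γ x := setIntegral_nonneg hTm fun x hx => hγ0 x (hTB hx)
  have hall : G / Λ * ∫ x in S, ‖Du x‖ ≤ c₁ * (D / (ε * r)) * (Λ * G * volume.real T) +
      c₁ * σ ^ (-q) * ε ^ (p - 1) * (Λ * G * (D / r) * volume.real (B ∩ {x | k < u x})) := by
    refine hleft.trans (h.trans ?_)
    gcongr
  have hrw : c₁ * (D / (ε * r)) * (Λ * G * volume.real T) +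
      c₁ * σ ^ (-q) * ε ^ (p - 1) * (Λ * G * (D / r) * volume.real (B ∩ {x | k < u x})) =
      G / Λ * (c₁ * Λ ^ 2 * (D / (ε * r) * volume.real T +
        σ ^ (-q) * ε ^ (p - 1) * (D / r) * volume.real (B ∩ {x | k < u x}))) := by
    field_simp
  rw [hrw] at hall
  exact le_of_mul_le_mul_left hall (by positivity)

/-- For w = v the lower growth bound reads 1 ≤ g x v / g x v, while a quotient by zero is 0.
Positivity is what allows the reference value of g to be cancelled. -/
theorem CondG1.pos (hg : IsGrowthFunction Ω g) (hg1 : CondG1 Ω g) {x : Eucl n} (hx : x ∈ Ω)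
    {v : ℝ} (hv : 0 < v) : 0 < g x v := by
  obtain ⟨p, q, hp, hpq, h⟩ := hg1
  refine lt_of_le_of_ne (hg.nonneg x hx v hv) fun h0 => ?_
  have := (h x hx v v hv le_rfl).1
  rw [← h0, div_zero, div_self hv.ne', Real.one_rpow] at this
  linarith

/-- Functions of the De Giorgi class satisfy the gradient estimate on level sets. -/
theorem exists_levelGradientBound (hg : IsGrowthFunction Ω g) (hg1 : CondG1 Ω g) {x₀ : Eucl n}
    {R : ℝ} (hball : Metric.ball x₀ R ⊆ Ω) {lam : ℝ → ℝ} (hg2 : CondG2 g x₀ R lam) (hM : 0 < M)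
    (hu : u ∈ DeGiorgiClass Ω g M) (hum : Measurable u) :
    ∃ (Du : Eucl n → Eucl n) (C p q : ℝ), HasWeakGradient Ω u Du ∧ 0 < C ∧ 1 < p ∧ 0 < q ∧
      LevelGradientBound u Du x₀ R lam M C p q := by
  obtain ⟨hMu, Du, hDu, p, q, c₁, κ, hp, hpq, hc₁, hκ, henergy⟩ := hu
  obtain ⟨-, hmono, hlam, ⟨δ₀, hδ0, hδ1, -, hdoub⟩, c, hc, hcomp⟩ := hg2
  set K : ℝ := max 1 (2 * M)
  have hK : 1 ≤ K := le_max_left _ _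
  set Λ : ℝ := c * K ^ c
  have hΛ : 0 < Λ := by positivity
  refine ⟨Du, c₁ * Λ ^ 2, p, q, hDu, by positivity, hp, by linarith, ?_⟩
  intro r hr hrR ρ hρ1 hρ2 k l D ε σ hkl hk hl hε hε1 hσ hσ1 hDM hup hlow
  have hρ0 : 0 < ρ := by linarith
  have hB8 : Metric.ball x₀ (8 * ρ) ⊆ Ω := (Metric.ball_subset_ball (by linarith)).trans hball
  have hBΩ : Metric.ball x₀ ρ ⊆ Ω := (Metric.ball_subset_ball (by linarith)).trans hball
  have hx₀ : x₀ ∈ Metric.ball x₀ ρ := Metric.mem_ball_self hρ0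
  set v := MPlus u x₀ k ρ with hv
  -- A real essential supremum is an upper bound only for an essentially bounded function, so
  -- boundedness must be supplied.
  have hbdd : IsBoundedUnder (· ≤ ·) (ae (volume.restrict (Metric.ball x₀ ρ)))
      fun x => max (u x - k) 0 := by
    refine ⟨max D 0, ?_⟩
    rw [eventually_map]
    filter_upwards [hup] with x hx
    exact max_le_max (by linarith) le_rfl
  have hne : NeBot (ae (volume.restrict (Metric.ball x₀ ρ))) := by
    rw [ae_neBot, Ne, Measure.restrict_eq_zero]
    exact (Metric.measure_ball_pos volume x₀ hρ0).ne'
  have hle_v : ∀ᵐ x ∂volume.restrict (Metric.ball x₀ ρ), max (u x - k) 0 ≤ v :=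
    ae_le_essSup hbdd
  -- This is where the failure of u ≤ k + ρ is used; it puts v in the range of (g₂).
  have hρv : ρ ≤ v := by
    by_contra hlt
    refine hlow ?_
    filter_upwards [hle_v] with x hx
    have := (le_max_left (u x - k) 0).trans hx
    linarith
  have hv0 : 0 < v := hρ0.trans_le hρv
  have hvD : v ≤ D := by
    have h1 : v ≤ max D 0 := by
      refine essSup_le_of_ae_le _ ?_
        (isCoboundedUnder_le_of_le _ (x := 0) fun x => le_max_right _ _)
      filter_upwards [hup] with x hx
      exact max_le_max (by linarith) le_rfl
    rcases le_total D 0 with h2 | h2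
    · rw [max_eq_right h2] at h1
      linarith
    · rwa [max_eq_left h2] at h1
  -- Monotonicity and the doubling condition pass from r to ρ ≥ r/2, as (3/2)^(1-δ₀) ≤ 2; hence the
  -- value 2M in K.
  have hlamr : lam r ≤ 2 * lam ρ := by
    have h1 := hdoub r ⟨hr, by linarith⟩
    have h2 : lam (r / 2) ≤ lam ρ := hmono ⟨by linarith, by linarith⟩ ⟨hρ0, by linarith⟩ hρ1
    have h3 : (3 / 2 : ℝ) ^ (1 - δ₀) ≤ 2 := by
      refine (Real.rpow_le_rpow_of_exponent_le (by norm_num) (show 1 - δ₀ ≤ 1 by linarith)).trans ?_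
      norm_num
    have h4 := (hlam (r / 2) ⟨by linarith, by linarith⟩).1
    nlinarith
  have hvK : v ≤ K * lam ρ := by
    have h1 := (hlam ρ ⟨hρ0, by linarith⟩).1
    calc v ≤ M * lam r := hvD.trans hDM
      _ ≤ M * (2 * lam ρ) := by gcongr
      _ = 2 * M * lam ρ := by ring
      _ ≤ K * lam ρ := by
        gcongr
        exact le_max_right _ _
  have hcompρ := fun x hx y hy => hcomp K hK ρ ⟨hρ0, by linarith⟩ x hx y hy v hρv hvK
  have hvρ : 0 < v / ρ := by positivity
  obtain ⟨ζ, hζ⟩ := exists_isCutoff x₀ hκ hρ0 hσ hσ1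
  have hDi : IntegrableOn Du (Metric.ball x₀ ρ) :=
    (hDu.locallyIntegrableOn_grad.integrableOn_compact_subset
      ((Metric.closedBall_subset_ball (by linarith)).trans hball)
      (isCompact_closedBall x₀ ρ)).mono_set Metric.ball_subset_closedBall
  have hE := (henergy x₀ ρ hρ0 hB8 k l hkl hk hl ε hε hε1 σ hσ hσ1 ζ hζ).1.integral_norm_le
    (G := g x₀ (v / ρ)) (Λ := Λ) hum hDi hζ (by linarith) hc₁ hρ0 hε hσ
    (hg1.pos hg (hBΩ hx₀) hvρ) hΛ ((hg.aemeasurable _ hvρ).mono_set hBΩ)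
    (fun x hx => hcompρ x₀ hx₀ x hx) (fun x hx => hcompρ x hx x₀ hx₀) hv0.le hvD hup
  have hSB : Metric.ball x₀ (ρ * (1 - σ)) ∩ {x | k < u x ∧ u x ≤ l} ⊆ Metric.ball x₀ ρ :=
    inter_subset_left.trans (Metric.ball_subset_ball (by nlinarith))
  rw [← ofReal_integral_norm_eq_lintegral_enorm (hDi.mono_set hSB)]
  exact ENNReal.ofReal_le_ofReal hE

end DeGiorgiClass

/-! ### Divergent dyadic sums, decay of the oscillation, continuous representatives -/

/-- The sums of `lam` over dyadic scales are unbounded if `∫₀ lam(t) dt / t` diverges. -/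
theorem tsum_dyadic_eq_top {R r₀ : ℝ} {lam : ℝ → ℝ} (hdiv : DivergesAtZero R lam)
    (hmono : MonotoneOn lam (Ioo 0 R)) (hlam : ∀ r ∈ Ioo 0 R, 0 < lam r) (hr₀ : 0 < r₀)
    (hr₀R : r₀ < R) : ∑' j : ℕ, ENNReal.ofReal (lam (r₀ * (1 / 2) ^ j)) = ⊤ := by
  rw [eq_top_iff, ← hdiv r₀ ⟨hr₀, hr₀R⟩]
  set d : ℕ → ℝ := fun j => r₀ * (1 / 2) ^ j with hd
  have hd0 : ∀ j, 0 < d j := fun j => by positivity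
  have hdR : ∀ j, d j < R := fun j =>
    (mul_le_of_le_one_right hr₀.le (pow_le_one₀ (by norm_num) (by norm_num))).trans_lt hr₀R
  have hcover : Ioo 0 r₀ ⊆ ⋃ j, Ioc (d (j + 1)) (d j) := by
    intro t ht
    obtain ⟨j, hj1, hj2⟩ := exists_nat_pow_near_of_lt_one (x := t / r₀) (y := (1 / 2 : ℝ))
      (div_pos ht.1 hr₀) ((div_le_one hr₀).2 ht.2.le) (by norm_num) (by norm_num)
    refine mem_iUnion.2 ⟨j, ?_, ?_⟩
    · rw [lt_div_iff₀ hr₀] at hj1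
      simpa [hd, mul_comm] using hj1
    · rw [div_le_iff₀ hr₀] at hj2
      simpa [hd, mul_comm] using hj2
  refine (lintegral_mono_set hcover).trans ((lintegral_iUnion_le _ _).trans ?_)
  refine ENNReal.tsum_le_tsum fun j => ?_
  have hds : d (j + 1) = d j / 2 := by
    simp only [hd, pow_succ]
    ring
  have hl := hlam (d j) ⟨hd0 j, hdR j⟩
  -- On this interval the integrand is at most λ(d j)/d (j + 1), and the length of the interval is d
  -- (j + 1).
  calc ∫⁻ t in Ioc (d (j + 1)) (d j), ENNReal.ofReal (lam t / t)
      ≤ ∫⁻ _ in Ioc (d (j + 1)) (d j), ENNReal.ofReal (lam (d j) / d (j + 1)) := by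
        refine setLIntegral_mono' measurableSet_Ioc fun t ht => ENNReal.ofReal_le_ofReal ?_
        have h1 := hd0 (j + 1)
        have h2 : 0 < t := h1.trans ht.1
        have h3 := hmono ⟨h2, ht.2.trans_lt (hdR j)⟩ ⟨hd0 j, hdR j⟩ ht.2
        have h4 := ht.1.le
        gcongr
    _ = ENNReal.ofReal (lam (d j)) := by
        rw [setLIntegral_const, Real.volume_Ioc, ← ENNReal.ofReal_mul
          (div_nonneg hl.le (hd0 _).le), hds]
        congr 1
        have := hd0 j
        field_simp
        ring

/-- Decay to zero of a sequence that loses a definite proportion at every dyadic scale, unless it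
is already small. -/
theorem tendsto_zero_of_dyadic_decay {R r₀ η δ₀ : ℝ} {lam : ℝ → ℝ} {osc : ℕ → ℝ}
    (hdiv : DivergesAtZero R lam) (hmono : MonotoneOn lam (Ioo 0 R))
    (hlam : ∀ r ∈ Ioo 0 R, 0 < lam r) (hδ₀ : 0 < δ₀)
    (hlim : Tendsto (fun r : ℝ => r ^ (1 - δ₀) / lam r) (𝓝[>] 0) (𝓝 0)) (hr₀ : 0 < r₀)
    (hr₀R : r₀ < R) (hη : 0 < η) (hω : Antitone osc) (hω0 : ∀ j, 0 ≤ osc j)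
    (hdecay : ∀ j, r₀ * (1 / 2) ^ j ≤ η * lam (r₀ * (1 / 2) ^ j) * osc j →
      osc (j + 1) ≤ osc j - η * lam (r₀ * (1 / 2) ^ j) * osc j) :
    Tendsto osc atTop (𝓝 0) := by
  set d : ℕ → ℝ := fun j => r₀ * (1 / 2) ^ j with hd
  have hd0 : ∀ j, 0 < d j := fun j => by positivity
  have hdR : ∀ j, d j < R := fun j =>
    (mul_le_of_le_one_right hr₀.le (pow_le_one₀ (by norm_num) (by norm_num))).trans_lt hr₀R
  have hdlim : Tendsto d atTop (𝓝 0) := by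
    simpa [hd] using (tendsto_pow_atTop_nhds_zero_of_lt_one (r := (1 / 2 : ℝ)) (by norm_num)
      (by norm_num)).const_mul r₀
  have hbdd : BddBelow (range osc) := ⟨0, by rintro _ ⟨j, rfl⟩; exact hω0 j⟩
  have hL := tendsto_atTop_ciInf hω hbdd
  set L := ⨅ j, osc j
  have hL0 : 0 ≤ L := le_ciInf hω0
  rcases hL0.eq_or_lt with h0 | h0
  · rwa [← h0] at hL
  exfalso
  have hωL : ∀ j, L ≤ osc j := fun j => ciInf_le hbdd j
  have hdlim' : Tendsto d atTop (𝓝[>] 0) :=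
    tendsto_nhdsWithin_iff.2 ⟨hdlim, Eventually.of_forall hd0⟩
  -- For d j < 1 one has d j ≤ (d j)^(1-δ₀), which is eventually below η L λ(d j). So a positive
  -- limit L makes every late step a reducing one.
  have hev : ∀ᶠ j in atTop, d j ≤ η * lam (d j) * L := by
    have h1 := (hlim.comp hdlim').eventually (gt_mem_nhds (show 0 < η * L by positivity))
    have h2 := hdlim.eventually (gt_mem_nhds one_pos)
    filter_upwards [h1, h2] with j hj1 hj2
    have hl := hlam (d j) ⟨hd0 j, hdR j⟩
    simp only [Function.comp_apply] at hj1
    rw [div_lt_iff₀ hl] at hj1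
    have h3 : d j ≤ d j ^ (1 - δ₀) := by
      conv_lhs => rw [← Real.rpow_one (d j)]
      exact Real.rpow_le_rpow_of_exponent_ge (hd0 j) hj2.le (by linarith)
    linarith
  obtain ⟨J, hJ⟩ := eventually_atTop.1 hev
  have hstep : ∀ i, η * L * lam (d (J + i)) ≤ osc (J + i) - osc (J + i + 1) := fun i => by
    have hl := hlam (d (J + i)) ⟨hd0 _, hdR _⟩
    have h1 : η * lam (d (J + i)) * L ≤ η * lam (d (J + i)) * osc (J + i) := by
      gcongr
      exact hωL _
    have h2 := hdecay (J + i) ((hJ (J + i) (by omega)).trans h1)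
    linarith
  have hsum : ∀ N, ∑ i ∈ Finset.range N, lam (d (J + i)) ≤ osc J / (η * L) := fun N => by
    rw [le_div_iff₀ (by positivity), mul_comm, Finset.mul_sum]
    calc ∑ i ∈ Finset.range N, η * L * lam (d (J + i))
        ≤ ∑ i ∈ Finset.range N, (osc (J + i) - osc (J + (i + 1))) :=
          Finset.sum_le_sum fun i _ => hstep i
      _ = osc (J + 0) - osc (J + N) := Finset.sum_range_sub' (fun i => osc (J + i)) N
      _ ≤ osc J := by
          have := hω0 (J + N)
          simp only [add_zero]
          linarith
  have hsummable := summable_of_sum_range_le (fun i => (hlam (d (J + i)) ⟨hd0 _, hdR _⟩).le) hsum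
  -- The tail from J on is the dyadic sequence started at d J, so its sum also diverges.
  have htop := tsum_dyadic_eq_top hdiv hmono hlam (hd0 J) (hdR J)
  refine hsummable.tsum_ofReal_ne_top ?_
  rw [← htop]
  refine tsum_congr fun i => ?_
  simp only [hd, pow_add]
  rw [mul_assoc]

/-- A function whose essential oscillation over the balls about `x₀` tends to zero has a
representative that is continuous at `x₀`. -/
theorem hasRepContinuousAt_of_nested_bounds {n : ℕ} (hn : 2 ≤ n) {Ω : Set (Eucl n)}
    {u : Eucl n → ℝ} {x₀ : Eucl n} {r m μ : ℕ → ℝ} (hr : ∀ j, 0 < r j)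
    (hm : Monotone m) (hμ : Antitone μ) (hmμ : ∀ j, m j ≤ μ j)
    (hu : ∀ j, ∀ᵐ x ∂volume.restrict (Metric.ball x₀ (r j)), m j ≤ u x ∧ u x ≤ μ j)
    (hlim : Tendsto (fun j => μ j - m j) atTop (𝓝 0)) : HasRepContinuousAt Ω u x₀ := by
  classical
  have hmc : ∀ i j, m i ≤ μ j := fun i j =>
    (hm (le_max_left i j)).trans ((hmμ _).trans (hμ (le_max_right i j)))
  set c := ⨆ i, m i
  have hbdd : BddAbove (range m) := ⟨μ 0, by rintro _ ⟨i, rfl⟩; exact hmc i 0⟩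
  have hc1 : ∀ j, m j ≤ c := fun j => le_ciSup hbdd j
  have hc2 : ∀ j, c ≤ μ j := fun j => ciSup_le fun i => hmc i j
  -- The constant c lies between all the bounds. Putting it at x₀ and on the null set where some
  -- bound fails makes the bounds hold everywhere, hence continuity at x₀.
  set w : Eucl n → ℝ := fun x =>
    if x ≠ x₀ ∧ ∀ j, x ∈ Metric.ball x₀ (r j) → m j ≤ u x ∧ u x ≤ μ j then u x else c with hw
  have hwB : ∀ j, ∀ x ∈ Metric.ball x₀ (r j), m j ≤ w x ∧ w x ≤ μ j := by
    intro j x hx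
    simp only [hw]
    split_ifs with h
    · exact h.2 j hx
    · exact ⟨hc1 j, hc2 j⟩
  have hwx₀ : w x₀ = c := by simp [hw]
  refine ⟨w, ?_, ?_⟩
  · refine ae_restrict_of_ae ?_
    have : Nonempty (Fin n) := ⟨⟨0, by omega⟩⟩
    have h1 : ∀ᵐ x ∂(volume : Measure (Eucl n)), x ≠ x₀ := by
      rw [ae_iff]
      simp
    have h2 : ∀ᵐ x ∂(volume : Measure (Eucl n)), ∀ j,
        x ∈ Metric.ball x₀ (r j) → m j ≤ u x ∧ u x ≤ μ j :=
      ae_all_iff.2 fun j => (ae_restrict_iff' measurableSet_ball).1 (hu j)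
    filter_upwards [h1, h2] with x hx1 hx2
    simp only [hw]
    rw [if_pos ⟨hx1, hx2⟩]
  · rw [Metric.continuousAt_iff]
    intro ε hε
    obtain ⟨j, hj⟩ := (hlim.eventually (gt_mem_nhds hε)).exists
    refine ⟨r j, hr j, fun {x} hx => ?_⟩
    obtain ⟨h1, h2⟩ := hwB j x hx
    have h3 := hc1 j
    have h4 := hc2 j
    rw [hwx₀, Real.dist_eq, abs_lt]
    constructor <;> linarith

/-! ### Reduction of the oscillation and continuity at the point -/

section oscillation
variable {n : ℕ} {Ω : Set (Eucl n)} {g : Eucl n → ℝ → ℝ} {u : Eucl n → ℝ} {x₀ : Eucl n}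
  {R M : ℝ} {lam : ℝ → ℝ}

/-- Reduction of the essential supremum for functions of the De Giorgi class. -/
theorem exists_sup_reduction (hn : 2 ≤ n) (hg : IsGrowthFunction Ω g) (hg1 : CondG1 Ω g)
    (hball : Metric.ball x₀ R ⊆ Ω) (hg2 : CondG2 g x₀ R lam) (hM : 0 < M)
    (hu : u ∈ DeGiorgiClass Ω g M) (hum : Measurable u) :
    ∃ η : ℝ, 0 < η ∧ η < 1 ∧ ∀ r : ℝ, 0 < r → r < R / 16 → ∀ m μ : ℝ, -M ≤ m → m < μ → μ ≤ M →
      (∀ᵐ x ∂volume.restrict (Metric.ball x₀ r), u x ≤ μ) →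
      1 / 2 * volume.real (Metric.ball x₀ (3 / 4 * r))
        ≤ volume.real (Metric.ball x₀ (3 / 4 * r) ∩ {x | u x ≤ (m + μ) / 2}) →
      r ≤ η * lam r * (μ - m) →
      ∀ᵐ x ∂volume.restrict (Metric.ball x₀ (r / 2)), u x ≤ μ - η * lam r * (μ - m) := by
  obtain ⟨Du, C, p, q, hDu, hC, hp, hq, hGB⟩ :=
    exists_levelGradientBound hg hg1 hball hg2 hM hu hum
  exact exists_reduction hn hDu hum hball hC hp hq hg2.2.2.1 hGB

/-- Reduction of the essential oscillation when the radius is halved. -/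
theorem exists_oscillation_reduction (hn : 2 ≤ n) (hg : IsGrowthFunction Ω g)
    (hg1 : CondG1 Ω g) (hball : Metric.ball x₀ R ⊆ Ω) (hg2 : CondG2 g x₀ R lam) (hM : 0 < M)
    (hu : u ∈ DeGiorgiClass Ω g M) (hum : Measurable u) :
    ∃ η : ℝ, 0 < η ∧ ∀ r : ℝ, 0 < r → r < R / 16 → ∀ m μ : ℝ, -M ≤ m → m ≤ μ → μ ≤ M →
      (∀ᵐ x ∂volume.restrict (Metric.ball x₀ r), m ≤ u x ∧ u x ≤ μ) →
      ∃ m' μ' : ℝ, m ≤ m' ∧ m' ≤ μ' ∧ μ' ≤ μ ∧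
        (∀ᵐ x ∂volume.restrict (Metric.ball x₀ (r / 2)), m' ≤ u x ∧ u x ≤ μ') ∧
        (r ≤ η * lam r * (μ - m) → μ' - m' ≤ (μ - m) - η * lam r * (μ - m)) := by
  obtain ⟨η₁, h10, h11, hred₁⟩ := exists_sup_reduction hn hg hg1 hball hg2 hM hu hum
  obtain ⟨η₂, h20, h21, hred₂⟩ := exists_sup_reduction hn hg hg1 hball hg2 hM
    (neg_mem_deGiorgiClass hu) hum.neg
  refine ⟨min η₁ η₂, lt_min h10 h20, fun r hr hrR m μ hm hmμ hμ hbd => ?_⟩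
  set η := min η₁ η₂
  have hη0 : 0 < η := lt_min h10 h20
  have hη1 : η ≤ η₁ := min_le_left _ _
  have hη2 : η ≤ η₂ := min_le_right _ _
  obtain ⟨hl0, hl1⟩ := hg2.2.2.1 r ⟨hr, by linarith⟩
  have hbd' := ae_restrict_of_ae_restrict_of_subset
    (Metric.ball_subset_ball (x := x₀) (by linarith : r / 2 ≤ r)) hbd
  by_cases hcase : m < μ ∧ r ≤ η * lam r * (μ - m)
  swap
  · refine ⟨m, μ, le_rfl, hmμ, le_rfl, hbd', fun hle => ?_⟩
    rcases hmμ.eq_or_lt with h | h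
    · simp [h]
    · exact absurd ⟨h, hle⟩ hcase
  obtain ⟨hlt, hrη⟩ := hcase
  have hω : 0 < μ - m := sub_pos.2 hlt
  have hηω : η * lam r * (μ - m) ≤ μ - m := by
    refine mul_le_of_le_one_left hω.le (mul_le_one₀ ?_ hl0.le hl1)
    linarith
  have hmono₁ : η * lam r * (μ - m) ≤ η₁ * lam r * (μ - m) := by gcongr
  have hmono₂ : η * lam r * (μ - m) ≤ η₂ * lam r * (μ - m) := by gcongr
  set B' := Metric.ball x₀ (3 / 4 * r)
  -- The two sets cover the ball, so u lies below the midpoint of m, μ, or -u below that of -μ, -m,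
  -- on at least half of it.
  have hhalf : volume.real B' ≤ volume.real (B' ∩ {x | u x ≤ (m + μ) / 2}) +
      volume.real (B' ∩ {x | -u x ≤ (-μ + -m) / 2}) := by
    refine le_trans (measureReal_mono ?_ ?_) (measureReal_union_le _ _)
    · intro x hx
      rcases le_total (u x) ((m + μ) / 2) with h | h
      · exact Or.inl ⟨hx, h⟩
      · refine Or.inr ⟨hx, ?_⟩
        change -u x ≤ (-μ + -m) / 2
        linarith
    · exact (measure_union_lt_top (volume_ball_inter_ne_top _ _).lt_top
        (volume_ball_inter_ne_top _ _).lt_top).ne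
  rcases le_or_gt (1 / 2 * volume.real B')
    (volume.real (B' ∩ {x | u x ≤ (m + μ) / 2})) with h | h
  · have := hred₁ r hr hrR m μ hm hlt hμ (hbd.mono fun x hx => hx.2) h (hrη.trans hmono₁)
    refine ⟨m, μ - η * lam r * (μ - m), le_rfl, by linarith, ?_, ?_, fun _ => by linarith⟩
    · have : 0 < η * lam r * (μ - m) := by positivity
      linarith
    · filter_upwards [hbd', this] with x hx hx'
      exact ⟨hx.1, by linarith⟩
  · have hω' : -m - -μ = μ - m := by ring
    have := hred₂ r hr hrR (-μ) (-m) (by linarith) (by linarith) (by linarith)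
      (hbd.mono fun x hx => by linarith [hx.1]) (by linarith)
      (by rw [hω']; exact hrη.trans hmono₂)
    rw [hω'] at this
    refine ⟨m + η * lam r * (μ - m), μ, ?_, by linarith, le_rfl, ?_, fun _ => by linarith⟩
    · have : 0 < η * lam r * (μ - m) := by positivity
      linarith
    · filter_upwards [hbd', this] with x hx hx'
      exact ⟨by linarith, hx.2⟩

/-- Continuity at `x₀` of the measurable functions of the De Giorgi class. -/
theorem hasRepContinuousAt_of_measurable (hn : 2 ≤ n) (hg : IsGrowthFunction Ω g)
    (hg1 : CondG1 Ω g) (hR : 0 < R) (hball : Metric.ball x₀ R ⊆ Ω) (hg2 : CondG2 g x₀ R lam)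
    (hdiv : DivergesAtZero R lam) (hM : 0 < M) (hu : u ∈ DeGiorgiClass Ω g M)
    (hum : Measurable u) : HasRepContinuousAt Ω u x₀ := by
  obtain ⟨η, hη, hosc⟩ := exists_oscillation_reduction hn hg hg1 hball hg2 hM hu hum
  obtain ⟨-, hmono, hlam, ⟨δ₀, hδ0, -, hlim, -⟩, -⟩ := hg2
  -- This start keeps all dyadic radii strictly below R/16.
  set r₀ : ℝ := R / 32 with hr₀
  set r : ℕ → ℝ := fun j => r₀ * (1 / 2) ^ j with hr
  have hr₀0 : 0 < r₀ := by positivity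
  have hr0 : ∀ j, 0 < r j := fun j => by positivity
  have hrR : ∀ j, r j < R / 16 := fun j => by
    have : r j ≤ r₀ := mul_le_of_le_one_right hr₀0.le (pow_le_one₀ (by norm_num) (by norm_num))
    linarith
  have hrs : ∀ j, r (j + 1) = r j / 2 := fun j => by
    simp only [hr, pow_succ]
    ring
  -- The bounds at successive radii are chosen recursively, starting from -M and M; `P` is the
  -- invariant that allows the next reduction.
  let P : ℕ → ℝ × ℝ → Prop := fun j s => -M ≤ s.1 ∧ s.1 ≤ s.2 ∧ s.2 ≤ M ∧
    ∀ᵐ x ∂volume.restrict (Metric.ball x₀ (r j)), s.1 ≤ u x ∧ u x ≤ s.2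
  have hnext : ∀ j (s : {s // P j s}), ∃ s' : {s' // P (j + 1) s'}, s.1.1 ≤ s'.1.1 ∧
      s'.1.2 ≤ s.1.2 ∧ (r j ≤ η * lam (r j) * (s.1.2 - s.1.1) →
        s'.1.2 - s'.1.1 ≤ (s.1.2 - s.1.1) - η * lam (r j) * (s.1.2 - s.1.1)) := by
    rintro j ⟨⟨m, μ⟩, hm, hmμ, hμ, hbd⟩
    obtain ⟨m', μ', h1, h2, h3, h4, h5⟩ := hosc (r j) (hr0 j) (hrR j) m μ hm hmμ hμ hbd
    rw [← hrs] at h4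
    exact ⟨⟨(m', μ'), hm.trans h1, h2, h3.trans hμ, h4⟩, h1, h3, h5⟩
  have hstart : P 0 (-M, M) := by
    refine ⟨le_rfl, by linarith, le_rfl, ?_⟩
    have hsub : Metric.ball x₀ (r 0) ⊆ Ω :=
      (Metric.ball_subset_ball (by linarith [hrR 0])).trans hball
    filter_upwards [ae_restrict_of_ae_restrict_of_subset hsub hu.1] with x hx
    exact abs_le.1 hx
  choose F hF using hnext
  let s : (j : ℕ) → {s // P j s} := fun j => Nat.rec ⟨(-M, M), hstart⟩ F j
  have hs : ∀ j, s (j + 1) = F j (s j) := fun j => rfl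
  have hm : Monotone fun j => (s j).1.1 := monotone_nat_of_le_succ fun j => by
    rw [hs]
    exact (hF j (s j)).1
  have hμ : Antitone fun j => (s j).1.2 := antitone_nat_of_succ_le fun j => by
    rw [hs]
    exact (hF j (s j)).2.1
  have hmμ : ∀ j, (s j).1.1 ≤ (s j).1.2 := fun j => (s j).2.2.1
  refine hasRepContinuousAt_of_nested_bounds hn (r := r) hr0 hm hμ hmμ
    (fun j => (s j).2.2.2.2) ?_
  refine tendsto_zero_of_dyadic_decay (r₀ := r₀) hdiv hmono (fun r hr => (hlam r hr).1) hδ0 hlim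
    hr₀0 (by linarith) hη (fun i j hij => sub_le_sub (hμ hij) (hm hij))
    (fun j => sub_nonneg.2 (hmμ j)) fun j hj => ?_
  rw [hs]
  exact (hF j (s j)).2.2 hj

end oscillation

end DeGiorgiB1

end

theorem theorem2p1 (n : ℕ) (hn : 2 ≤ n)
    (Ω : Set (DeGiorgiB1.Eucl n)) (hΩo : IsOpen Ω) (hΩc : IsConnected Ω)
    (hΩb : Bornology.IsBounded Ω)
    (g : DeGiorgiB1.Eucl n → ℝ → ℝ) (hg : DeGiorgiB1.IsGrowthFunction Ω g)
    (hg1 : DeGiorgiB1.CondG1 Ω g)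
    (x₀ : DeGiorgiB1.Eucl n) (hx₀ : x₀ ∈ Ω)
    (R : ℝ) (hR : 0 < R) (hball : Metric.ball x₀ R ⊆ Ω)
    (lam : ℝ → ℝ) (hg2 : DeGiorgiB1.CondG2 g x₀ R lam)
    (hdiv : DeGiorgiB1.DivergesAtZero R lam)
    (M : ℝ) (u : DeGiorgiB1.Eucl n → ℝ) (hu : u ∈ DeGiorgiB1.DeGiorgiClass Ω g M) :
    DeGiorgiB1.HasRepContinuousAt Ω u x₀ := by
  -- For M ≤ 0 the bound forces u = 0 almost everywhere; the level arguments assume M > 0.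
  rcases le_or_gt M 0 with hM | hM
  · refine ⟨fun _ => 0, ?_, continuousAt_const⟩
    filter_upwards [hu.1] with x hx
    exact (abs_eq_zero.1 (le_antisymm (hx.trans hM) (abs_nonneg _))).symm
  -- Local integrability makes u almost everywhere measurable in Ω, which yields the Borel
  -- representative.
  · have hD := hu.2.choose_spec.1.locallyIntegrableOn.aestronglyMeasurable.aemeasurable
    obtain ⟨w, hw, hwc⟩ := DeGiorgiB1.hasRepContinuousAt_of_measurable hn hg hg1 hR hball hg2 hdiv
      hM (DeGiorgiB1.deGiorgiClass_congr hu hD.ae_eq_mk) hD.measurable_mk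
    exact ⟨w, hw.trans hD.ae_eq_mk.symm, hwc⟩
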